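/- Let $(\mathcal H,[\cdot,\cdot])$ be a complex Krein space: a complex vector space with a Hermitian sesquilinear form that admits a fundamental decomposition, i.e. a direct sum decomposition $\mathcal H=\mathcal H_+\,[\dotplus]\,\mathcal H_-$, orthogonal with respect to $[\cdot,\cdot]$, such that $(\mathcal H_+,[\cdot,\cdot])$ and $(\mathcal H_-,-[\cdot,\cdot])$ are Hilbert spaces. With each fundamental decomposition are associated the signature operator $J=P_+-P_-$, where $P_\pm$ is the projection onto $\mathcal H_\pm$ with nullspace $\mathcal H_\mp$, and the Hilbert space inner product $\langle x,y\rangle=[Jx,y]$ on $\mathcal H$. The resulting norms are all equivalent; closed subspaces and the algebra $L(\mathcal H)$ of bounded operators refer to them. Let $N(T)$ and $R(T)$ denote the nullspace and the range of $T$; let $T^{\#}$ be the operator with $[Tx,y]=[x,T^{\#}y]$ for all $x,y$; write $X\le Y$ if $Y-X$ is positive, i.e. $(Y-X)^{\#}=Y-X$ and $[(Y-X)x,x]\ge 0$ for all $x$; and let $\mathcal Q=\{E\in L(\mathcal H):E^2=E\}$. For a selfadjoint bounded operator $B$ on a Hilbert space and a closed subspace $\mathcal S$, write $B=\begin{pmatrix}a&b\\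 b^*&c\end{pmatrix}$ with respect to $\mathcal S\oplus\mathcal S^\perp$. Then $B$ is $\mathcal S$-weakly complementable if $R(b)\subseteq R(|a|^{1/2})$; in that case its Schur complement is $B_{/\mathcal S}=\begin{pmatrix}0&0\\0&c-f^*uf\end{pmatrix}$, where $f$ is the reduced solution of $b=|a|^{1/2}x$ (the solution with $N(f)=N(b)$ and $R(f)\subseteq\overline{R(|a|^{1/2})}$) and $a=u|a|$ is the polar decomposition of $a$, $u$ being the partial isometry with $N(u)=N(a)$. An operator $W\in L(\mathcal H)$ with $W=W^{\#}$ is $\mathcal S$-weakly complementable if, for some signature operator $J$, the operator $JW$ is $\mathcal S$-weakly complementable in the associated Hilbert space. Then this holds for every signature operator $J$, and the Schur complement $W_{/[\mathcal S]}:=J\,(JW)_{/\mathcal S}$ does not depend on $J$. Theorem. Let $W\in L(\mathcal H)$ with $W=W^{\#}$ and let $\mathcal S$ be a closed subspace of $\mathcal H$. Let $\mathcal S=\mathcal S_+\dotplus\mathcal S_-$ be a direct sum decomposition with $\mathcal S_\pm$ closed, $[Ws,t]=0$ for $s\in\mathcal S_+$ and $t\in\mathcal S_-$, $[Ws,s]\ge0$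 for $s\in\mathcal S_+$, $[Ws,s]\le 0$ for $s\in\mathcal S_-$, and $\mathcal S_+\perp\mathcal S_-$ in the Hilbert space associated with some signature operator. Then $W$ is $\mathcal S$-weakly complementable if and only if both $$\sup_{E_-\in\mathcal Q,\ N(E_-)=\mathcal S_-}\Big(\inf_{E_+\in\mathcal Q,\ N(E_+)=\mathcal S_+}E_-^{\#}E_+^{\#}WE_+E_-\Big)\quad\text{and}\quad \inf_{E_+\in\mathcal Q,\ N(E_+)=\mathcal S_+}\Big(\sup_{E_-\in\mathcal Q,\ N(E_-)=\mathcal S_-}E_+^{\#}E_-^{\#}WE_-E_+\Big)$$ exist with respect to $\le$ (including the existence of all the inner infima and suprema). In this case both are equal to $W_{/[\mathcal S]}$. -/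

import Mathlib

open ContinuousLinearMap Filter Topology

noncomputable section

namespace SchurHilbert

section Douglas

variable {E F G : Type*}
  [NormedAddCommGroup E] [InnerProductSpace ℂ E] [CompleteSpace E]
  [NormedAddCommGroup F] [InnerProductSpace ℂ F] [CompleteSpace F]
  [NormedAddCommGroup G] [InnerProductSpace ℂ G] [CompleteSpace G]

/-- `D` is the reduced solution of the equation `Z = Y X`: it solves the equation,
`N(D) = N(Z)`, and `R(D)` is contained in the closure of `R(Y^*)`. -/
def IsReducedSolution (Y : E →L[ℂ] G) (Z : F →L[ℂ] G) (D : F →L[ℂ] E) : Prop :=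
  Z = Y ∘L D ∧ D.ker = Z.ker ∧ D.range ≤ (adjoint Y).range.topologicalClosure

theorem exists_isReducedSolution (Y : E →L[ℂ] G) (Z : F →L[ℂ] G)
    (h : Z.range ≤ Y.range) : ∃ D : F →L[ℂ] E, IsReducedSolution Y Z D := by
  have hex : ∀ z : F, ∃ d : E, d ∈ Y.kerᗮ ∧ Y d = Z z := by
    intro z
    obtain ⟨e, he⟩ := h ⟨z, rfl⟩
    refine ⟨Y.kerᗮ.starProjection e, Submodule.starProjection_apply_mem _ _, ?_⟩
    have h1 : e - Y.kerᗮ.starProjection e ∈ Y.ker := by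
      have := Submodule.sub_starProjection_mem_orthogonal (K := Y.kerᗮ) e
      rwa [Submodule.orthogonal_orthogonal_eq_closure,
        (ContinuousLinearMap.isClosed_ker Y).submodule_topologicalClosure_eq] at this
    have h2 : Y (e - Y.kerᗮ.starProjection e) = 0 := h1
    rw [map_sub, sub_eq_zero] at h2
    rw [← h2]
    exact he
  have huniq : ∀ d d' : E, d ∈ Y.kerᗮ → d' ∈ Y.kerᗮ → Y d = Y d' → d = d' := by
    intro d d' hd hd' hh
    have h1 : d - d' ∈ Y.ker := by
      change Y (d - d') = 0
      rw [map_sub, hh, sub_self]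
    have h2 : d - d' ∈ Y.kerᗮ := Submodule.sub_mem _ hd hd'
    have h3 : d - d' ∈ Y.ker ⊓ Y.kerᗮ := ⟨h1, h2⟩
    rw [Submodule.inf_orthogonal_eq_bot] at h3
    exact sub_eq_zero.mp h3
  choose D hD hYD using hex
  let Dl : F →ₗ[ℂ] E :=
    { toFun := D
      map_add' := fun x y => huniq _ _ (hD _) (Submodule.add_mem _ (hD _) (hD _))
        (by simp [hYD])
      map_smul' := fun c x => huniq _ _ (hD _) (Submodule.smul_mem _ _ (hD _))
        (by simp [hYD]) }
  have hDl : ∀ x, Dl x = D x := fun _ => rfl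
  let Dc : F →L[ℂ] E := ContinuousLinearMap.ofSeqClosedGraph (g := Dl) (by
    intro u x y hu hy
    refine huniq _ _ ?_ (hD x) ?_
    · exact (Submodule.isClosed_orthogonal _).mem_of_tendsto hy
        (Eventually.of_forall fun n => hD (u n))
    · have t1 : Tendsto (fun n => Y (Dl (u n))) atTop (𝓝 (Y y)) :=
        (Y.continuous.tendsto y).comp hy
      have t2 : Tendsto (fun n => Y (Dl (u n))) atTop (𝓝 (Z x)) := by
        simp only [hDl, hYD]
        exact (Z.continuous.tendsto x).comp hu
      rw [tendsto_nhds_unique t1 t2]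
      exact (hYD x).symm)
  have hDc : ∀ x, Dc x = D x := fun _ => rfl
  refine ⟨Dc, ?_, ?_, ?_⟩
  · ext x
    simp [hDc, hYD]
  · ext x
    constructor
    · intro hx
      have hx' : D x = 0 := hx
      change Z x = 0
      rw [← hYD, hx', map_zero]
    · intro hx
      have hx' : Z x = 0 := hx
      change D x = 0
      exact huniq _ _ (hD x) (Submodule.zero_mem _) (by rw [hYD, hx', map_zero])
  · rintro _ ⟨x, rfl⟩
    rw [← ContinuousLinearMap.orthogonal_ker]
    exact hD x

/-- The reduced solution of `Z = Y X`, which exists as soon as `R(Z) ⊆ R(Y)`. -/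
def reducedSolution (Y : E →L[ℂ] G) (Z : F →L[ℂ] G) (h : Z.range ≤ Y.range) : F →L[ℂ] E :=
  Classical.choose (exists_isReducedSolution Y Z h)

theorem reducedSolution_spec (Y : E →L[ℂ] G) (Z : F →L[ℂ] G) (h : Z.range ≤ Y.range) :
    IsReducedSolution Y Z (reducedSolution Y Z h) :=
  Classical.choose_spec (exists_isReducedSolution Y Z h)

end Douglas

section Polar

variable {E : Type*} [NormedAddCommGroup E] [InnerProductSpace ℂ E] [CompleteSpace E]

/-- `u` is the partial isometry in the polar decomposition `a = u |a|`, normalised by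
`N(u) = N(a)`. -/
def IsPolarFactor (a u : E →L[ℂ] E) : Prop :=
  a = u ∘L CFC.abs a ∧ (∀ x ∈ u.kerᗮ, ‖u x‖ = ‖x‖) ∧ u.ker = a.ker

theorem norm_abs_apply (a : E →L[ℂ] E) (x : E) : ‖CFC.abs a x‖ = ‖a x‖ := by
  have hsa : adjoint (CFC.abs a) = CFC.abs a := (CFC.abs_nonneg a).isSelfAdjoint
  have h1 : inner ℂ (CFC.abs a x) (CFC.abs a x) = inner ℂ (a x) (a x) := by
    rw [← ContinuousLinearMap.adjoint_inner_right, hsa]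
    rw [← ContinuousLinearMap.adjoint_inner_right a]
    have := congrArg (fun T : E →L[ℂ] E => T x) (CFC.abs_mul_abs a)
    simp only [mul_apply_eq_comp] at this
    rw [this]
    rfl
  rw [inner_self_eq_norm_sq_to_K, inner_self_eq_norm_sq_to_K] at h1
  have h2 : ‖CFC.abs a x‖ ^ 2 = ‖a x‖ ^ 2 := by exact_mod_cast h1
  exact (sq_eq_sq₀ (norm_nonneg _) (norm_nonneg _)).mp h2

theorem exists_isPolarFactor (a : E →L[ℂ] E) : ∃ u : E →L[ℂ] E, IsPolarFactor a u := by
  let m := CFC.abs a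
  let M : Submodule ℂ E := m.range.topologicalClosure
  have : CompleteSpace M := (Submodule.isClosed_topologicalClosure _).completeSpace_coe
  have hmem : ∀ x, m x ∈ M := fun x => Submodule.le_topologicalClosure _ ⟨x, rfl⟩
  let e : E →ₗ[ℂ] M := m.toLinearMap.codRestrict M hmem
  have hnorm : ∀ x, ‖a x‖ = ‖e x‖ := fun x => (norm_abs_apply a x).symm
  have hdense : DenseRange e := by
    intro y
    rw [Metric.mem_closure_range_iff]
    intro ε hε
    obtain ⟨_, ⟨x, rfl⟩, hx⟩ := Metric.mem_closure_iff.mp y.2 ε hε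
    exact ⟨x, hx⟩
  have hb : ∃ C, ∀ x, ‖a.toLinearMap x‖ ≤ C * ‖e x‖ := ⟨1, fun x => by
    rw [one_mul, ← hnorm]; rfl⟩
  let v : M →L[ℂ] E := a.toLinearMap.extendOfNorm e
  have hv : ∀ x, v (e x) = a x := fun x => LinearMap.extendOfNorm_eq hdense hb x
  have hviso : ∀ y, ‖v y‖ = ‖y‖ := by
    intro y
    refine hdense.induction_on (p := fun y => ‖v y‖ = ‖y‖) y ?_ ?_
    · exact isClosed_eq (by fun_prop) (by fun_prop)
    · intro x
      rw [hv, hnorm]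
  let u : E →L[ℂ] E := v ∘L M.orthogonalProjectionOnto
  have hu : ∀ x, ‖u x‖ = ‖M.orthogonalProjectionOnto x‖ := fun x => hviso _
  have huker : u.ker = Mᗮ := by
    ext x
    rw [← Submodule.orthogonalProjectionOnto_eq_zero_iff]
    change u x = 0 ↔ _
    rw [← norm_eq_zero, hu, norm_eq_zero]
  have hMa : Mᗮ = a.ker := by
    have h1 : Mᗮ = m.rangeᗮ := Submodule.orthogonal_closure _
    have hsa : adjoint m = m := (CFC.abs_nonneg a).isSelfAdjoint
    rw [h1, ContinuousLinearMap.orthogonal_range, hsa]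
    ext x
    change m x = 0 ↔ a x = 0
    rw [← norm_eq_zero, norm_abs_apply, norm_eq_zero]
  refine ⟨u, ?_, ?_, huker.trans hMa⟩
  · ext x
    have h1 : M.orthogonalProjectionOnto (m x) = e x :=
      Submodule.orthogonalProjectionOnto_mem_subspace_eq_self (e x)
    change a x = v (M.orthogonalProjectionOnto (m x))
    rw [h1, hv]
  · intro x hx
    rw [huker, Submodule.orthogonal_orthogonal] at hx
    have h1 : M.orthogonalProjectionOnto x = ⟨x, hx⟩ :=
      Submodule.orthogonalProjectionOnto_mem_subspace_eq_self (⟨x, hx⟩ : M)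
    rw [hu, h1]
    rfl

/-- The operator `|a|^{1/2}`. -/
def sqrtAbs (a : E →L[ℂ] E) : E →L[ℂ] E :=
  CFC.sqrt (CFC.abs a)

/-- The partial isometry of the polar decomposition of `a`. -/
def polarFactor (a : E →L[ℂ] E) : E →L[ℂ] E :=
  Classical.choose (exists_isPolarFactor a)

theorem polarFactor_spec (a : E →L[ℂ] E) : IsPolarFactor a (polarFactor a) :=
  Classical.choose_spec (exists_isPolarFactor a)

end Polar

section Schur

variable {E : Type*} [NormedAddCommGroup E] [InnerProductSpace ℂ E] [CompleteSpace E]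

/-- The entry `a : S → S` of the block matrix of `B` with respect to `S ⊕ Sᗮ`. -/
def blockA (B : E →L[ℂ] E) (S : Submodule ℂ E) [CompleteSpace S] : S →L[ℂ] S :=
  S.orthogonalProjectionOnto ∘L B ∘L S.subtypeL

/-- The entry `b : Sᗮ → S` of the block matrix of `B` with respect to `S ⊕ Sᗮ`. -/
def blockB (B : E →L[ℂ] E) (S : Submodule ℂ E) [CompleteSpace S] : Sᗮ →L[ℂ] S :=
  S.orthogonalProjectionOnto ∘L B ∘L Sᗮ.subtypeL

/-- The entry `c : Sᗮ → Sᗮ` of the block matrix of `B` with respect to `S ⊕ Sᗮ`. -/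
def blockC (B : E →L[ℂ] E) (S : Submodule ℂ E) [CompleteSpace S] : Sᗮ →L[ℂ] Sᗮ :=
  Sᗮ.orthogonalProjectionOnto ∘L B ∘L Sᗮ.subtypeL

/-- `B` is `S`-weakly complementable: `R(b) ⊆ R(|a|^{1/2})`. -/
def WeaklyComplementable (B : E →L[ℂ] E) (S : Submodule ℂ E) [CompleteSpace S] : Prop :=
  (blockB B S).range ≤ (sqrtAbs (blockA B S)).range

/-- The Schur complement of `B` to `S`: the operator with block matrix
`[0, 0; 0, c - f^* u f]`, where `f` is the reduced solution of `b = |a|^{1/2} x` and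
`a = u |a|` is the polar decomposition of `a`. -/
def schurComplement (B : E →L[ℂ] E) (S : Submodule ℂ E) [CompleteSpace S]
    (h : WeaklyComplementable B S) : E →L[ℂ] E :=
  let f : Sᗮ →L[ℂ] S := reducedSolution (sqrtAbs (blockA B S)) (blockB B S) h
  let u : S →L[ℂ] S := polarFactor (blockA B S)
  Sᗮ.subtypeL ∘L (blockC B S - adjoint f ∘L u ∘L f) ∘L Sᗮ.orthogonalProjectionOnto

end Schur

end SchurHilbert

end

noncomputable section

/-- A complex linear space with an indefinite metric: a Hermitian sesquilinear form, here
conjugate linear in the first variable and linear in the second one. -/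
class IndefiniteMetric (H : Type*) [AddCommGroup H] [Module ℂ H] where
  form : H →ₗ⋆[ℂ] H →ₗ[ℂ] ℂ
  conj_symm : ∀ x y, (starRingEnd ℂ) (form y x) = form x y

namespace IndefiniteMetric

variable {H : Type*} [AddCommGroup H] [Module ℂ H] [IndefiniteMetric H]

/-- `M` is a Hilbert space for the form `σ [x, y]`, with `σ = 1` or `σ = -1`: the form is positive
definite on `M` and `M` is complete (every Cauchy sequence converges in `M`). -/
def IsHilbertSubspace (σ : ℝ) (M : Submodule ℂ H) : Prop :=
  (∀ x ∈ M, x ≠ 0 → 0 < σ * (form x x).re) ∧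
  ∀ v : ℕ → H, (∀ n, v n ∈ M) →
    (∀ ε : ℝ, 0 < ε → ∃ N, ∀ m ≥ N, ∀ n ≥ N, σ * (form (v m - v n) (v m - v n)).re < ε) →
    ∃ x ∈ M, Tendsto (fun n => σ * (form (v n - x) (v n - x)).re) atTop (𝓝 0)

end IndefiniteMetric

open IndefiniteMetric

/-- A fundamental decomposition `H = H₊ [∔] H₋`. -/
structure FundamentalDecomposition (H : Type*) [AddCommGroup H] [Module ℂ H]
    [IndefiniteMetric H] where
  pos : Submodule ℂ H
  neg : Submodule ℂ H
  isCompl : IsCompl pos neg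
  orthogonal : ∀ x ∈ pos, ∀ y ∈ neg, form x y = 0
  hilbert_pos : IsHilbertSubspace 1 pos
  hilbert_neg : IsHilbertSubspace (-1) neg

namespace FundamentalDecomposition

section Algebraic

variable {H : Type*} [AddCommGroup H] [Module ℂ H] [IndefiniteMetric H]
  (D : FundamentalDecomposition H)

/-- The projection onto `H₊` with nullspace `H₋`. -/
def projPos : H →ₗ[ℂ] H := D.pos.projection D.neg D.isCompl

/-- The projection onto `H₋` with nullspace `H₊`. -/
def projNeg : H →ₗ[ℂ] H := D.neg.projection D.pos D.isCompl.symm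

/-- The signature operator `J = P₊ - P₋`. -/
def signature : H →ₗ[ℂ] H := D.projPos - D.projNeg

theorem projPos_mem (x : H) : D.projPos x ∈ D.pos := Submodule.projection_apply_mem _ _

theorem projNeg_mem (x : H) : D.projNeg x ∈ D.neg := Submodule.projection_apply_mem _ _

theorem projPos_of_mem_pos {x : H} (hx : x ∈ D.pos) : D.projPos x = x :=
  Submodule.projection_apply_of_mem_left _ hx

theorem projPos_of_mem_neg {x : H} (hx : x ∈ D.neg) : D.projPos x = 0 :=
  Submodule.projection_apply_of_mem_right _ hx

theorem projNeg_of_mem_neg {x : H} (hx : x ∈ D.neg) : D.projNeg x = x :=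
  Submodule.projection_apply_of_mem_left _ hx

theorem projNeg_of_mem_pos {x : H} (hx : x ∈ D.pos) : D.projNeg x = 0 :=
  Submodule.projection_apply_of_mem_right _ hx

theorem projPos_add_projNeg (x : H) : D.projPos x + D.projNeg x = x := by
  obtain ⟨p, hp, q, hq, rfl⟩ := Submodule.mem_sup.mp
    (show x ∈ D.pos ⊔ D.neg by rw [D.isCompl.sup_eq_top]; trivial)
  simp [D.projPos_of_mem_pos hp, D.projPos_of_mem_neg hq, D.projNeg_of_mem_pos hp,
    D.projNeg_of_mem_neg hq]

theorem orthogonal' {x y : H} (hx : x ∈ D.neg) (hy : y ∈ D.pos) : form x y = 0 := by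
  rw [← conj_symm, D.orthogonal y hy x hx, map_zero]

theorem signature_signature (x : H) : D.signature (D.signature x) = x := by
  conv_rhs => rw [← D.projPos_add_projNeg x]
  simp [signature, D.projPos_of_mem_pos (D.projPos_mem x), D.projPos_of_mem_neg (D.projNeg_mem x),
    D.projNeg_of_mem_pos (D.projPos_mem x), D.projNeg_of_mem_neg (D.projNeg_mem x)]

theorem form_signature (x y : H) : form (D.signature x) y =
    form (D.projPos x) (D.projPos y) - form (D.projNeg x) (D.projNeg y) := by
  conv_lhs => rw [← D.projPos_add_projNeg y]
  simp [signature, D.orthogonal _ (D.projPos_mem x) _ (D.projNeg_mem y),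
    D.orthogonal' (D.projNeg_mem x) (D.projPos_mem y)]

theorem form_signature_comm (x y : H) : form (D.signature x) y = form x (D.signature y) := by
  rw [← conj_symm x, D.form_signature, D.form_signature, map_sub, conj_symm, conj_symm]

theorem form_pos_nonneg {x : H} (hx : x ∈ D.pos) : 0 ≤ (form x x).re := by
  by_cases h : x = 0
  · simp [h]
  · simpa using (D.hilbert_pos.1 x hx h).le

theorem form_neg_nonpos {x : H} (hx : x ∈ D.neg) : (form x x).re ≤ 0 := by
  by_cases h : x = 0
  · simp [h]
  · simpa using (D.hilbert_neg.1 x hx h).le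

/-- The space `H` regarded as a Hilbert space with the inner product `⟨x, y⟩ = [J x, y]`. -/
def Hilb (_ : FundamentalDecomposition H) : Type _ := H

instance : AddCommGroup D.Hilb := inferInstanceAs (AddCommGroup H)

instance : Module ℂ D.Hilb := inferInstanceAs (Module ℂ H)

/-- The identity map of `H`, as a linear equivalence onto the associated Hilbert space. -/
def toHilbₗ : H ≃ₗ[ℂ] D.Hilb := LinearEquiv.refl ℂ H

/-- The inner product `⟨x, y⟩ = [J x, y]`. -/
@[reducible] def innerCore : InnerProductSpace.Core ℂ D.Hilb where
  inner x y := form (D.signature (D.toHilbₗ.symm x)) (D.toHilbₗ.symm y)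
  conj_inner_symm x y := by
    rw [conj_symm, D.form_signature_comm]
  re_inner_nonneg x := by
    change 0 ≤ (form _ _).re
    rw [D.form_signature, Complex.sub_re]
    have h1 := D.form_pos_nonneg (D.projPos_mem (D.toHilbₗ.symm x))
    have h2 := D.form_neg_nonpos (D.projNeg_mem (D.toHilbₗ.symm x))
    linarith
  add_left x y z := by simp
  smul_left x y r := by simp
  definite x hx := by
    have h0 : (form (D.signature (D.toHilbₗ.symm x)) (D.toHilbₗ.symm x)).re = 0 := by
      rw [hx]; rfl
    rw [D.form_signature, Complex.sub_re] at h0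
    have h1 := D.form_pos_nonneg (D.projPos_mem (D.toHilbₗ.symm x))
    have h2 := D.form_neg_nonpos (D.projNeg_mem (D.toHilbₗ.symm x))
    have h3 : D.projPos (D.toHilbₗ.symm x) = 0 := by
      by_contra h
      have := D.hilbert_pos.1 _ (D.projPos_mem _) h
      linarith
    have h4 : D.projNeg (D.toHilbₗ.symm x) = 0 := by
      by_contra h
      have := D.hilbert_neg.1 _ (D.projNeg_mem _) h
      linarith
    have h5 : D.toHilbₗ.symm x = 0 := by
      rw [← D.projPos_add_projNeg (D.toHilbₗ.symm x), h3, h4, add_zero]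
    simpa using h5

instance : NormedAddCommGroup D.Hilb := D.innerCore.toNormedAddCommGroup

instance : InnerProductSpace ℂ D.Hilb := InnerProductSpace.ofCore D.innerCore.toCore

theorem inner_toHilbₗ (x y : H) :
    inner ℂ (D.toHilbₗ x) (D.toHilbₗ y) = form (D.signature x) y := rfl

theorem norm_sq_toHilbₗ (x : H) : ‖D.toHilbₗ x‖ ^ 2 =
    (form (D.projPos x) (D.projPos x)).re - (form (D.projNeg x) (D.projNeg x)).re := by
  rw [← Complex.sub_re, ← D.form_signature, ← D.inner_toHilbₗ]
  exact (inner_self_eq_norm_sq (𝕜 := ℂ) (D.toHilbₗ x)).symm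

instance : CompleteSpace D.Hilb := by
  refine Metric.complete_of_cauchySeq_tendsto fun u hu => ?_
  let w : ℕ → H := fun n => D.toHilbₗ.symm (u n)
  have hw : ∀ n, u n = D.toHilbₗ (w n) := fun n => by simp [w]
  have key : ∀ ε : ℝ, 0 < ε → ∃ N, ∀ m ≥ N, ∀ n ≥ N,
      ‖D.toHilbₗ (w m - w n)‖ ^ 2 < ε := by
    intro ε hε
    obtain ⟨N, hN⟩ := Metric.cauchySeq_iff.mp hu (√ε) (Real.sqrt_pos.mpr hε)
    refine ⟨N, fun m hm n hn => ?_⟩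
    have h := hN m hm n hn
    rw [dist_eq_norm, hw, hw, ← map_sub] at h
    calc ‖D.toHilbₗ (w m - w n)‖ ^ 2 < (√ε) ^ 2 := by gcongr
      _ = ε := Real.sq_sqrt hε.le
  obtain ⟨p, hp, hpt⟩ := D.hilbert_pos.2 (fun n => D.projPos (w n)) (fun n => D.projPos_mem _) (by
    intro ε hε
    obtain ⟨N, hN⟩ := key ε hε
    refine ⟨N, fun m hm n hn => ?_⟩
    have h := hN m hm n hn
    rw [D.norm_sq_toHilbₗ] at h
    have h2 := D.form_neg_nonpos (D.projNeg_mem (w m - w n))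
    rw [← map_sub]
    linarith)
  obtain ⟨q, hq, hqt⟩ := D.hilbert_neg.2 (fun n => D.projNeg (w n)) (fun n => D.projNeg_mem _) (by
    intro ε hε
    obtain ⟨N, hN⟩ := key ε hε
    refine ⟨N, fun m hm n hn => ?_⟩
    have h := hN m hm n hn
    rw [D.norm_sq_toHilbₗ] at h
    have h2 := D.form_pos_nonneg (D.projPos_mem (w m - w n))
    rw [← map_sub]
    linarith)
  refine ⟨D.toHilbₗ (p + q), ?_⟩
  rw [tendsto_iff_norm_sub_tendsto_zero]
  have hsq : Tendsto (fun n => ‖u n - D.toHilbₗ (p + q)‖ ^ 2) atTop (𝓝 0) := by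
    have h := hpt.add hqt
    rw [add_zero] at h
    refine h.congr fun n => ?_
    rw [hw, ← map_sub, D.norm_sq_toHilbₗ]
    simp only [map_sub, map_add, D.projPos_of_mem_pos hp, D.projPos_of_mem_neg hq,
      D.projNeg_of_mem_pos hp, D.projNeg_of_mem_neg hq, add_zero, zero_add]
    ring
  have h := (Real.continuous_sqrt.tendsto 0).comp hsq
  rw [Real.sqrt_zero] at h
  refine h.congr fun n => ?_
  simp [Real.sqrt_sq]

/-- The topology of `H` given by the norm of the associated Hilbert space. -/
@[reducible] def topology : TopologicalSpace H :=
  TopologicalSpace.induced D.toHilbₗ inferInstance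

theorem inner_signature (x y : H) :
    inner ℂ (D.toHilbₗ x) (D.toHilbₗ (D.signature y)) = form x y := by
  rw [D.inner_toHilbₗ, ← D.form_signature_comm, D.signature_signature]

/-- The identity map between the Hilbert spaces of two fundamental decompositions is bounded. -/
theorem continuous_change (D D' : FundamentalDecomposition H) :
    Continuous (fun x : D.Hilb => D'.toHilbₗ (D.toHilbₗ.symm x)) := by
  refine LinearMap.continuous_of_seq_closed_graph
    (g := (D.toHilbₗ.symm.trans D'.toHilbₗ).toLinearMap) fun u x y hu hy => ?_
  have key : ∀ z : H, form (D'.toHilbₗ.symm y) z = form (D.toHilbₗ.symm x) z := by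
    intro z
    have t1 : Tendsto (fun n => form (D.toHilbₗ.symm (u n)) z) atTop
        (𝓝 (form (D.toHilbₗ.symm x) z)) := by
      simp only [← D.inner_signature, LinearEquiv.apply_symm_apply]
      exact hu.inner tendsto_const_nhds
    have t2 : Tendsto (fun n => form (D.toHilbₗ.symm (u n)) z) atTop
        (𝓝 (form (D'.toHilbₗ.symm y) z)) := by
      simp only [← D'.inner_signature, LinearEquiv.apply_symm_apply]
      exact hy.inner tendsto_const_nhds
    exact tendsto_nhds_unique t2 t1
  have h0 : y - D'.toHilbₗ (D.toHilbₗ.symm x) = 0 := by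
    rw [← inner_self_eq_zero (𝕜 := ℂ)]
    have := key (D'.signature (D'.toHilbₗ.symm (y - D'.toHilbₗ (D.toHilbₗ.symm x))))
    rw [← D'.inner_signature, ← D'.inner_signature, D'.signature_signature,
      LinearEquiv.apply_symm_apply, LinearEquiv.apply_symm_apply] at this
    rw [inner_sub_left, this, sub_self]
  exact sub_eq_zero.mp h0

theorem topology_eq (D D' : FundamentalDecomposition H) : D.topology = D'.topology := by
  have key : ∀ D D' : FundamentalDecomposition H, D.topology ≤ D'.topology := by
    intro D D'
    rw [topology, topology, ← continuous_iff_le_induced]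
    let _ : TopologicalSpace H := TopologicalSpace.induced D.toHilbₗ inferInstance
    exact (continuous_change D D').comp continuous_induced_dom
  exact le_antisymm (key D D') (key D' D)

end Algebraic

end FundamentalDecomposition

/-- A Krein space: an indefinite metric space that admits a fundamental decomposition, with the
topology given by the norm of the associated Hilbert space. This topology does not depend on the
fundamental decomposition (`FundamentalDecomposition.topology_eq`), so that `H →L[ℂ] H` is the
space of the linear operators which are bounded in an associated Hilbert space. -/
class KreinSpace (H : Type*) [AddCommGroup H] [Module ℂ H] [TopologicalSpace H] extends
    IndefiniteMetric H where
  exists_decomposition : ∃ D : FundamentalDecomposition H, ‹TopologicalSpace H› = D.topology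

namespace FundamentalDecomposition

variable {H : Type*} [AddCommGroup H] [Module ℂ H] [tH : TopologicalSpace H] [KreinSpace H]
  (D : FundamentalDecomposition H)

theorem krein_topology : tH = D.topology := by
  obtain ⟨D', h⟩ := KreinSpace.exists_decomposition (H := H)
  exact h.trans (topology_eq D' D)

theorem isInducing_toHilbₗ : IsInducing D.toHilbₗ := ⟨D.krein_topology⟩

/-- The identity map of `H`, as a continuous linear equivalence onto the associated
Hilbert space. -/
def toHilb : H ≃L[ℂ] D.Hilb where
  toLinearEquiv := D.toHilbₗ
  continuous_toFun := D.isInducing_toHilbₗ.continuous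
  continuous_invFun := D.isInducing_toHilbₗ.continuous_iff.mpr
    (continuous_id.congr fun x => (D.toHilbₗ.apply_symm_apply x).symm)

theorem norm_signature (x : H) : ‖D.toHilb (D.signature x)‖ = ‖D.toHilb x‖ := by
  have h : inner ℂ (D.toHilbₗ (D.signature x)) (D.toHilbₗ (D.signature x)) =
      inner ℂ (D.toHilbₗ x) (D.toHilbₗ x) := by
    rw [D.inner_signature, D.inner_toHilbₗ]
  rw [inner_self_eq_norm_sq_to_K, inner_self_eq_norm_sq_to_K] at h
  have h2 : ‖D.toHilbₗ (D.signature x)‖ ^ 2 = ‖D.toHilbₗ x‖ ^ 2 := by exact_mod_cast h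
  exact (sq_eq_sq₀ (norm_nonneg _) (norm_nonneg _)).mp h2

/-- The signature operator on the associated Hilbert space. -/
def signatureHilb : D.Hilb →L[ℂ] D.Hilb :=
  LinearMap.mkContinuous
    (D.toHilbₗ.toLinearMap ∘ₗ D.signature ∘ₗ D.toHilbₗ.symm.toLinearMap) 1 (fun x => by
      rw [one_mul]
      have := D.norm_signature (D.toHilb.symm x)
      rw [ContinuousLinearEquiv.apply_symm_apply] at this
      exact this.le)

/-- An operator of `L(H)` regarded as an operator on the associated Hilbert space. -/
def opHilb (T : H →L[ℂ] H) : D.Hilb →L[ℂ] D.Hilb :=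
  D.toHilb.toContinuousLinearMap ∘L T ∘L D.toHilb.symm.toContinuousLinearMap

/-- An operator on the associated Hilbert space regarded as an operator of `L(H)`. -/
def opKrein (T : D.Hilb →L[ℂ] D.Hilb) : H →L[ℂ] H :=
  D.toHilb.symm.toContinuousLinearMap ∘L T ∘L D.toHilb.toContinuousLinearMap

/-- The operator `J W` on the associated Hilbert space. -/
def signatureMul (W : H →L[ℂ] H) : D.Hilb →L[ℂ] D.Hilb :=
  D.signatureHilb ∘L D.opHilb W

/-- A closed subspace of `H` regarded as a subspace of the associated Hilbert space. -/
def subspace (S : ClosedSubmodule ℂ H) : Submodule ℂ D.Hilb :=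
  S.toSubmodule.comap D.toHilbₗ.symm.toLinearMap

instance (S : ClosedSubmodule ℂ H) : CompleteSpace (D.subspace S) :=
  (S.isClosed.preimage D.toHilb.symm.continuous).completeSpace_coe

end FundamentalDecomposition

namespace KreinSpace

variable {H : Type*} [AddCommGroup H] [Module ℂ H] [TopologicalSpace H] [KreinSpace H]

instance isTopologicalAddGroup : IsTopologicalAddGroup H := by
  obtain ⟨D, -⟩ := KreinSpace.exists_decomposition (H := H)
  exact D.isInducing_toHilbₗ.topologicalAddGroup D.toHilbₗ

theorem form_ext {x y : H} (h : ∀ z : H, form z x = form z y) : x = y := by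
  obtain ⟨D, -⟩ := KreinSpace.exists_decomposition (H := H)
  apply D.toHilbₗ.injective
  refine ext_inner_left ℂ fun v => ?_
  have := h (D.signature (D.toHilbₗ.symm v))
  rw [← D.inner_toHilbₗ, ← D.inner_toHilbₗ, LinearEquiv.apply_symm_apply] at this
  exact this

theorem existsUnique_adjoint (T : H →L[ℂ] H) :
    ∃! T' : H →L[ℂ] H, ∀ x y, form (T x) y = form x (T' y) := by
  obtain ⟨D, -⟩ := KreinSpace.exists_decomposition (H := H)
  refine ⟨D.opKrein (D.signatureHilb ∘L adjoint (D.opHilb T) ∘L D.signatureHilb), ?_, ?_⟩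
  · intro x y
    rw [← D.inner_signature (T x) y, ← D.inner_signature x]
    change inner ℂ (D.opHilb T (D.toHilb x)) (D.signatureHilb (D.toHilb y)) =
      inner ℂ (D.toHilb x) (D.toHilbₗ (D.signature (D.signature (D.toHilb.symm
        (adjoint (D.opHilb T) (D.signatureHilb (D.toHilb y)))))))
    rw [D.signature_signature, ← ContinuousLinearMap.adjoint_inner_right]
    rfl
  · intro T' hT'
    refine ContinuousLinearMap.ext fun y => form_ext fun z => ?_
    rw [← hT' z y]
    rw [← D.inner_signature (T z) y, ← D.inner_signature z]
    change inner ℂ (D.opHilb T (D.toHilb z)) (D.signatureHilb (D.toHilb y)) =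
      inner ℂ (D.toHilb z) (D.toHilbₗ (D.signature (D.signature (D.toHilb.symm
        (adjoint (D.opHilb T) (D.signatureHilb (D.toHilb y)))))))
    rw [D.signature_signature, ← ContinuousLinearMap.adjoint_inner_right]
    rfl

/-- The adjoint `T^#`: the unique operator of `L(H)` with `[T x, y] = [x, T^# y]`. -/
def kadjoint (T : H →L[ℂ] H) : H →L[ℂ] H := (existsUnique_adjoint T).choose

theorem form_kadjoint (T : H →L[ℂ] H) (x y : H) : form (T x) y = form x (kadjoint T y) :=
  (existsUnique_adjoint T).choose_spec.1 x y

/-- `T = T^#`. -/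
def IsKSelfAdjoint (T : H →L[ℂ] H) : Prop := kadjoint T = T

/-- `T` is selfadjoint and `[T x, x] ≥ 0` for every `x`. -/
def IsKPositive (T : H →L[ℂ] H) : Prop := IsKSelfAdjoint T ∧ ∀ x, 0 ≤ (form (T x) x).re

/-- The order of `L(H)`: `X ≤ Y` when `Y - X` is positive. -/
def KLE (X Y : H →L[ℂ] H) : Prop := IsKPositive (Y - X)

/-- `X` is the infimum of the set of operators `A`. -/
def IsKInf (A : Set (H →L[ℂ] H)) (X : H →L[ℂ] H) : Prop :=
  (∀ Y ∈ A, KLE X Y) ∧ ∀ Z, (∀ Y ∈ A, KLE Z Y) → KLE Z X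

/-- `X` is the supremum of the set of operators `A`. -/
def IsKSup (A : Set (H →L[ℂ] H)) (X : H →L[ℂ] H) : Prop :=
  (∀ Y ∈ A, KLE Y X) ∧ ∀ Z, (∀ Y ∈ A, KLE Y Z) → KLE X Z

/-- The bounded projections `E = E²` with nullspace `S`. -/
def projectionsWithKer (S : ClosedSubmodule ℂ H) : Set (H →L[ℂ] H) :=
  {E | E ∘L E = E ∧ ∀ x, E x = 0 ↔ x ∈ S}

/-- `X` is the supremum, over the projections `E₋` with `N(E₋) = S₋`, of the infima, over the
projections `E₊` with `N(E₊) = S₊`, of `E₋^# E₊^# W E₊ E₋`. All the infima are required to exist;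
`g E₋` is the one that belongs to `E₋`. -/
def IsSupInf (W : H →L[ℂ] H) (Sp Sm : ClosedSubmodule ℂ H) (X : H →L[ℂ] H) : Prop :=
  ∃ g : (H →L[ℂ] H) → (H →L[ℂ] H),
    (∀ Em ∈ projectionsWithKer Sm,
      IsKInf ((fun Ep => kadjoint Em ∘L kadjoint Ep ∘L W ∘L Ep ∘L Em) '' projectionsWithKer Sp)
        (g Em)) ∧
    IsKSup (g '' projectionsWithKer Sm) X

/-- `X` is the infimum, over the projections `E₊` with `N(E₊) = S₊`, of the suprema, over the
projections `E₋` with `N(E₋) = S₋`, of `E₊^# E₋^# W E₋ E₊`. All the suprema are required to exist;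
`g E₊` is the one that belongs to `E₊`. -/
def IsInfSup (W : H →L[ℂ] H) (Sp Sm : ClosedSubmodule ℂ H) (X : H →L[ℂ] H) : Prop :=
  ∃ g : (H →L[ℂ] H) → (H →L[ℂ] H),
    (∀ Ep ∈ projectionsWithKer Sp,
      IsKSup ((fun Em => kadjoint Ep ∘L kadjoint Em ∘L W ∘L Em ∘L Ep) '' projectionsWithKer Sm)
        (g Ep)) ∧
    IsKInf (g '' projectionsWithKer Sp) X

/-- `S = S₊ [∔]_W S₋` with `S₊` `W`-nonnegative and `S₋` `W`-nonpositive, where moreover `S₊` and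
`S₋` are orthogonal in the Hilbert space associated with `D`. -/
structure IsDecomposition (D : FundamentalDecomposition H) (W : H →L[ℂ] H)
    (S Sp Sm : ClosedSubmodule ℂ H) : Prop where
  disjoint : Disjoint Sp.toSubmodule Sm.toSubmodule
  sum_eq : Sp.toSubmodule ⊔ Sm.toSubmodule = S.toSubmodule
  form_eq_zero : ∀ s ∈ Sp, ∀ t ∈ Sm, form (W s) t = 0
  nonneg : ∀ s ∈ Sp, 0 ≤ (form (W s) s).re
  nonpos : ∀ s ∈ Sm, (form (W s) s).re ≤ 0
  inner_eq_zero : ∀ s ∈ Sp, ∀ t ∈ Sm, inner ℂ (D.toHilb s) (D.toHilb t) = 0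

/-- `W` is `S`-weakly complementable with respect to the signature operator `J` of `D`: the operator
`J W` is `S`-weakly complementable in the associated Hilbert space. -/
def WeaklyComplementableWrt (D : FundamentalDecomposition H) (W : H →L[ℂ] H)
    (S : ClosedSubmodule ℂ H) : Prop :=
  SchurHilbert.WeaklyComplementable (D.signatureMul W) (D.subspace S)

/-- `W` is `S`-weakly complementable: it is so with respect to some signature operator. -/
def WeaklyComplementable (W : H →L[ℂ] H) (S : ClosedSubmodule ℂ H) : Prop :=
  ∃ D : FundamentalDecomposition H, WeaklyComplementableWrt D W S

/-- The Schur complement `J (J W)_{/S}` of `W` to `S` corresponding to the signature operator `J`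
of `D`. -/
def schurComplementWrt (D : FundamentalDecomposition H) (W : H →L[ℂ] H)
    (S : ClosedSubmodule ℂ H) (h : WeaklyComplementableWrt D W S) : H →L[ℂ] H :=
  D.opKrein (D.signatureHilb ∘L
    SchurHilbert.schurComplement (D.signatureMul W) (D.subspace S) h)

end KreinSpace

end

noncomputable section

namespace SchurHilbert

/-! ### Polar decomposition of a selfadjoint operator: `a = r u r` with `r = |a|^{1/2}`. -/

section Polar

variable {E : Type*} [NormedAddCommGroup E] [InnerProductSpace ℂ E] [CompleteSpace E]

/-! Write Q(x) = [Wx, x]. Both iterated extrema are the value of the game (p, m) ↦ Q(x - p - m),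
minimised over p ∈ S₊ and maximised over m ∈ S₋, and the Schur complement is the operator whose
quadratic form is that value. Projections enter only because, for x ∉ S, the vectors E x with N(E) =
S fill the class x - S (`exists_projection_apply_eq`). For x ∈ S they all vanish, and the sign of W
on S₊ or S₋ covers this degenerate case.

Everything is reduced to a condition free of signature operators, `FormBounded`: each functional
[Wx, ·] is bounded on S for the seminorm (Q(p) - Q(m))^{1/2} of p + m. Weak complementability says
the same with the seminorm ‖|a|^{1/2} ·‖, a being the compression of JW to S, so the two seminorms
must be shown equivalent for every J. Each is the majorant ⟨a v ·, ·⟩ of the form ⟨a ·, ·⟩ given by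
a bounded symmetry v: the polar factor u for one, p + m ↦ p - m for the other. The product of two
such symmetries is symmetric for either majorant, and a bounded operator that is symmetric for a
semidefinite bounded form is bounded in its seminorm (`norm_apply_le_of_symmetric`). This gives
`IsDecomposition.exists_equiv`.

If W is weakly complementable, some s = p + m in S makes x - s almost W-orthogonal to S while Q(x -
s) is almost the Schur form at x (`exists_approx`). Expanding Q around x - s and absorbing the small
cross term turns (p, m) into an approximate saddle point (`IsDecomposition.isSaddleValue`). The
inner infimum is then E₋^# T E₋, with T the Schur complement to S₊ alone, and the saddle
inequalities identify the outer supremum (`IsDecomposition.isSupInf`). The other extremum follows by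
passing to -W.

Conversely, an inner infimum bounds Q from below on a class modulo S₊, and a discriminant argument
bounds [Wx, ·] on S₊. The inner suprema do the same on S₋, and together they give `FormBounded`. -/

theorem adjoint_abs (a : E →L[ℂ] E) : adjoint (CFC.abs a) = CFC.abs a :=
  (CFC.abs_nonneg a).isSelfAdjoint

theorem adjoint_sqrtAbs (a : E →L[ℂ] E) : adjoint (sqrtAbs a) = sqrtAbs a :=
  (CFC.sqrt_nonneg (CFC.abs a)).isSelfAdjoint

theorem inner_sqrtAbs (a : E →L[ℂ] E) (x y : E) :
    inner ℂ (sqrtAbs a x) y = inner ℂ x (sqrtAbs a y) := by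
  rw [← adjoint_inner_right, adjoint_sqrtAbs]

theorem sqrtAbs_sqrtAbs (a : E →L[ℂ] E) (x : E) : sqrtAbs a (sqrtAbs a x) = CFC.abs a x :=
  congrArg (fun T : E →L[ℂ] E => T x) (CFC.sqrt_mul_sqrt_self (CFC.abs a) (CFC.abs_nonneg a))

theorem polarFactor_abs (a : E →L[ℂ] E) (x : E) : polarFactor a (CFC.abs a x) = a x :=
  (congrArg (fun T : E →L[ℂ] E => T x) (polarFactor_spec a).1).symm

theorem polarFactor_of_apply_eq_zero {a : E →L[ℂ] E} {x : E} (hx : a x = 0) :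
    polarFactor a x = 0 := by
  have h : x ∈ (polarFactor a).ker := by
    rw [(polarFactor_spec a).2.2]
    exact hx
  exact h

theorem abs_apply_eq_zero_iff {a : E →L[ℂ] E} {x : E} : CFC.abs a x = 0 ↔ a x = 0 := by
  rw [← norm_eq_zero, norm_abs_apply, norm_eq_zero]

theorem sqrtAbs_of_apply_eq_zero {a : E →L[ℂ] E} {x : E} (hx : a x = 0) : sqrtAbs a x = 0 := by
  rw [← inner_self_eq_zero (𝕜 := ℂ), inner_sqrtAbs, sqrtAbs_sqrtAbs, abs_apply_eq_zero_iff.mpr hx,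
    inner_zero_right]

/-- Two operators that agree on `R(|a|)` and on `N(a)` are equal. -/
theorem ext_abs (a : E →L[ℂ] E) {X Y : E →L[ℂ] E}
    (h₁ : ∀ x, X (CFC.abs a x) = Y (CFC.abs a x)) (h₂ : ∀ x, a x = 0 → X x = Y x) : X = Y := by
  have hc : (CFC.abs a).range.topologicalClosure ≤ (X - Y).ker := by
    refine Submodule.topologicalClosure_minimal _ ?_ (ContinuousLinearMap.isClosed_ker _)
    rintro _ ⟨x, rfl⟩
    exact sub_eq_zero.mpr (h₁ x)
  ext x
  let N : Submodule ℂ E := (CFC.abs a).ker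
  have : CompleteSpace N := (ContinuousLinearMap.isClosed_ker (CFC.abs a)).completeSpace_coe
  have hx1 : X (N.starProjection x) = Y (N.starProjection x) :=
    h₂ _ (abs_apply_eq_zero_iff.mp (Submodule.starProjection_apply_mem N x))
  have hx2 : x - N.starProjection x ∈ (X - Y).ker := by
    apply hc
    have h := Submodule.sub_starProjection_mem_orthogonal (K := N) x
    rwa [show Nᗮ = (CFC.abs a).kerᗮ from rfl, ContinuousLinearMap.orthogonal_ker,
      adjoint_abs] at h
  have hx3 : X (x - N.starProjection x) = Y (x - N.starProjection x) := sub_eq_zero.mp hx2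
  rw [map_sub, map_sub, hx1] at hx3
  exact sub_left_injective hx3

variable {a : E →L[ℂ] E} (ha : IsSelfAdjoint a)
include ha

theorem abs_apply_apply (x : E) : CFC.abs a (a x) = a (CFC.abs a x) :=
  congrArg (fun T : E →L[ℂ] E => T x) (CFC.commute_abs_self a ha.isStarNormal)

theorem commute_abs_polarFactor : Commute (CFC.abs a) (polarFactor a) := by
  refine ext_abs a (fun x => ?_) (fun x hx => ?_)
  · change CFC.abs a (polarFactor a (CFC.abs a x)) = polarFactor a (CFC.abs a (CFC.abs a x))
    rw [polarFactor_abs, polarFactor_abs, abs_apply_apply ha]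
  · change CFC.abs a (polarFactor a x) = polarFactor a (CFC.abs a x)
    rw [polarFactor_of_apply_eq_zero hx, abs_apply_eq_zero_iff.mpr hx, map_zero, map_zero]

theorem polarFactor_abs_comm (x : E) :
    CFC.abs a (polarFactor a x) = polarFactor a (CFC.abs a x) :=
  congrArg (fun T : E →L[ℂ] E => T x) (commute_abs_polarFactor ha)

/-- The square root is a functional calculus of `|a|`, so it commutes with whatever commutes with
`|a|`. -/
theorem polarFactor_sqrtAbs_comm (x : E) :
    sqrtAbs a (polarFactor a x) = polarFactor a (sqrtAbs a x) :=
  congrArg (fun T : E →L[ℂ] E => T x)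
    ((commute_abs_polarFactor ha).cfcₙ_nnreal NNReal.sqrt : Commute (sqrtAbs a) (polarFactor a))

/-- This symmetric factorisation turns the form of `a` into ⟨u r x, r y⟩, which is bounded for the
seminorm ‖r ·‖. -/
theorem apply_eq_sqrtAbs_polarFactor (x : E) :
    a x = sqrtAbs a (polarFactor a (sqrtAbs a x)) := by
  rw [polarFactor_sqrtAbs_comm ha, sqrtAbs_sqrtAbs, polarFactor_abs]

theorem abs_abs_apply (x : E) : CFC.abs a (CFC.abs a x) = a (a x) := by
  have h := congrArg (fun T : E →L[ℂ] E => T x) (CFC.abs_mul_abs a)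
  rw [ha.star_eq] at h
  exact h

theorem polarFactor_polarFactor_abs (x : E) :
    polarFactor a (polarFactor a (CFC.abs a x)) = CFC.abs a x := by
  have h : polarFactor a ∘L polarFactor a ∘L CFC.abs a = CFC.abs a := by
    refine ext_abs a (fun x => ?_) (fun x hx => ?_)
    · change polarFactor a (polarFactor a (CFC.abs a (CFC.abs a x))) = CFC.abs a (CFC.abs a x)
      rw [polarFactor_abs, ← abs_apply_apply ha, polarFactor_abs, abs_abs_apply ha]
    · simp [abs_apply_eq_zero_iff.mpr hx]
  exact congrArg (fun T : E →L[ℂ] E => T x) h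

theorem polarFactor_polarFactor_sqrtAbs (x : E) :
    polarFactor a (polarFactor a (sqrtAbs a x)) = sqrtAbs a x := by
  have h : polarFactor a ∘L polarFactor a ∘L sqrtAbs a = sqrtAbs a := by
    refine ext_abs a (fun x => ?_) (fun x hx => ?_)
    · change polarFactor a (polarFactor a (sqrtAbs a (CFC.abs a x))) = sqrtAbs a (CFC.abs a x)
      have hc : sqrtAbs a (CFC.abs a x) = CFC.abs a (sqrtAbs a x) := by
        simp only [← sqrtAbs_sqrtAbs]
      rw [hc, polarFactor_polarFactor_abs ha]
    · simp [sqrtAbs_of_apply_eq_zero hx]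
  exact congrArg (fun T : E →L[ℂ] E => T x) h

/-- On R(|a|) both sides give `a`, because `u` commutes with `|a|`. On N(a), the identity |a| u^* =
a sends u^* x into N(a) = N(u), whence ‖u^* x‖² = ⟨x, u u^* x⟩ = 0. -/
theorem adjoint_polarFactor : adjoint (polarFactor a) = polarFactor a := by
  have h₁ : ∀ x, CFC.abs a (adjoint (polarFactor a) x) = a x := by
    intro x
    have h : adjoint (polarFactor a ∘L CFC.abs a) = a := by
      rw [← (polarFactor_spec a).1]
      exact ha
    rw [ContinuousLinearMap.adjoint_comp, adjoint_abs] at h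
    exact congrArg (fun T : E →L[ℂ] E => T x) h
  refine ext_abs a (fun x => ?_) (fun x hx => ?_)
  · have h : CFC.abs a ∘L polarFactor a = a := by
      ext y
      change CFC.abs a (polarFactor a y) = a y
      rw [polarFactor_abs_comm ha, polarFactor_abs]
    have h' := congrArg adjoint h
    rw [ContinuousLinearMap.adjoint_comp, adjoint_abs] at h'
    rw [polarFactor_abs]
    refine (congrArg (fun T : E →L[ℂ] E => T x) h').trans ?_
    exact congrArg (fun T : E →L[ℂ] E => T x) ha
  · rw [polarFactor_of_apply_eq_zero hx]
    have h2 : a (adjoint (polarFactor a) x) = 0 := by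
      rw [← abs_apply_eq_zero_iff, h₁, hx]
    rw [← inner_self_eq_zero (𝕜 := ℂ), adjoint_inner_left, polarFactor_of_apply_eq_zero h2,
      inner_zero_right]

theorem inner_polarFactor (x y : E) :
    inner ℂ (polarFactor a x) y = inner ℂ x (polarFactor a y) := by
  rw [← adjoint_inner_right, adjoint_polarFactor ha]

theorem inner_apply_polarFactor (x : E) :
    inner ℂ (a (polarFactor a x)) x = inner ℂ (sqrtAbs a x) (sqrtAbs a x) := by
  rw [apply_eq_sqrtAbs_polarFactor ha, inner_sqrtAbs, polarFactor_sqrtAbs_comm ha,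
    polarFactor_polarFactor_sqrtAbs ha]

omit ha in
/-- A vector `z` such that the functional `⟨z, ·⟩` is bounded by the seminorm `‖r ·‖` belongs to
the range of the selfadjoint operator `r`. -/
theorem mem_range_of_norm_inner_le {r : E →L[ℂ] E} (hr : adjoint r = r) {z : E} {C : ℝ}
    (h : ∀ s, ‖inner ℂ z s‖ ^ 2 ≤ C * ‖r s‖ ^ 2) : z ∈ r.range := by
  let M : Submodule ℂ E := r.range.topologicalClosure
  have : CompleteSpace M := (Submodule.isClosed_topologicalClosure _).completeSpace_coe
  let e : E →ₗ[ℂ] M := r.toLinearMap.codRestrict M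
    (fun x => Submodule.le_topologicalClosure _ ⟨x, rfl⟩)
  have hdense : DenseRange e := by
    intro y
    rw [Metric.mem_closure_range_iff]
    intro ε hε
    obtain ⟨_, ⟨x, rfl⟩, hx⟩ := Metric.mem_closure_iff.mp y.2 ε hε
    exact ⟨x, hx⟩
  -- By the bound, ⟨z, s⟩ depends only on `r s` and extends continuously to the closure of R(r). Its
  -- Riesz representative `w` there satisfies z = r w.
  let l : E →ₗ[ℂ] ℂ := (innerSL ℂ z).toLinearMap
  have hb : ∃ C', ∀ x, ‖l x‖ ≤ C' * ‖e x‖ := by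
    refine ⟨√|C|, fun x => ?_⟩
    refine le_of_sq_le_sq ?_ (by positivity)
    rw [mul_pow, Real.sq_sqrt (abs_nonneg C)]
    refine (h x).trans ?_
    gcongr
    · exact le_abs_self C
    · exact le_rfl
  let v : M →L[ℂ] ℂ := l.extendOfNorm e
  have hv : ∀ x, v (e x) = inner ℂ z x := fun x => LinearMap.extendOfNorm_eq hdense hb x
  let w : M := (InnerProductSpace.toDual ℂ M).symm v
  refine ⟨(w : E), ext_inner_right ℂ fun s => ?_⟩
  rw [← hv, ← InnerProductSpace.toDual_symm_apply]
  change inner ℂ (r (w : E)) s = inner ℂ (w : E) (r s)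
  rw [← adjoint_inner_right, hr]

end Polar

/-! ### Comparison of the majorants of a Hermitian form. -/

section Majorant

variable {E : Type*} [NormedAddCommGroup E] [InnerProductSpace ℂ E] [CompleteSpace E]

omit [CompleteSpace E] in
/-- A bounded operator that is symmetric for the semidefinite form `⟨R ·, R ·⟩` is bounded for
the corresponding seminorm. -/
theorem norm_apply_le_of_symmetric (R T : E →L[ℂ] E)
    (h : ∀ x y, inner ℂ (R (T x)) (R y) = inner ℂ (R x) (R (T y))) (x : E) :
    ‖R (T x)‖ ≤ (‖T‖ + 1) * ‖R x‖ := by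
  have hpow : ∀ k : ℕ, ∀ x y,
      inner ℂ (R ((T ^ k) x)) (R y) = inner ℂ (R x) (R ((T ^ k) y)) := by
    intro k
    induction k with
    | zero => intro x y; simp
    | succ k ih =>
      intro x y
      rw [pow_succ]
      change inner ℂ (R ((T ^ k) (T x))) (R y) = inner ℂ (R x) (R ((T ^ k) (T y)))
      have hc : T ((T ^ k) y) = (T ^ k) (T y) :=
        congrArg (fun V : E →L[ℂ] E => V y) ((pow_succ' T k).symm.trans (pow_succ T k))
      rw [ih, h, hc]
  -- Symmetry moves T^k across, and Cauchy–Schwarz then trades a square for a doubled exponent.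
  have hsq : ∀ k : ℕ, ‖R ((T ^ k) x)‖ ^ 2 ≤ ‖R x‖ * ‖R ((T ^ (2 * k)) x)‖ := by
    intro k
    have h1 : inner ℂ (R ((T ^ k) x)) (R ((T ^ k) x)) = inner ℂ (R x) (R ((T ^ (2 * k)) x)) := by
      rw [hpow, two_mul, pow_add]
      rfl
    have h2 := norm_inner_le_norm (𝕜 := ℂ) (R x) (R ((T ^ (2 * k)) x))
    rw [← h1, inner_self_eq_norm_sq_to_K] at h2
    simpa using h2
  set M := ‖T‖ + 1 with hM
  have hM0 : 0 < M := by positivity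
  by_cases h0 : ‖R x‖ = 0
  · have := hsq 1
    rw [h0, zero_mul, pow_one] at this
    have h1 : ‖R (T x)‖ = 0 := by
      have h2 : ‖R (T x)‖ ^ 2 = 0 := le_antisymm this (by positivity)
      exact pow_eq_zero_iff (two_ne_zero) |>.mp h2
    rw [h1, h0, mul_zero]
  have hpos : 0 < ‖R x‖ := lt_of_le_of_ne (norm_nonneg _) (Ne.symm h0)
  -- Repeated doubling gives (b 0)^(2^n) ≤ b n, whereas b n is at most a constant times M^(2^n). As
  -- n grows the constant becomes irrelevant, which forces b 0 ≤ M.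
  let b : ℕ → ℝ := fun n => ‖R ((T ^ (2 ^ n)) x)‖ / ‖R x‖
  have hb : ∀ n, (b 0) ^ (2 ^ n) ≤ b n := by
    intro n
    induction n with
    | zero => simp
    | succ n ih =>
      have h1 : (b n) ^ 2 ≤ b (n + 1) := by
        simp only [b, div_pow]
        rw [div_le_div_iff₀ (by positivity) hpos]
        have := hsq (2 ^ n)
        rw [← pow_succ'] at this
        calc _ ≤ (‖R x‖ * ‖R ((T ^ 2 ^ (n + 1)) x)‖) * ‖R x‖ := by gcongr
          _ = _ := by ring
      calc b 0 ^ 2 ^ (n + 1) = (b 0 ^ 2 ^ n) ^ 2 := by rw [← pow_mul, pow_succ]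
        _ ≤ (b n) ^ 2 := by gcongr
        _ ≤ _ := h1
  have hbd : ∀ n, b n ≤ (‖R‖ * ‖x‖ / ‖R x‖) * M ^ (2 ^ n) := by
    intro n
    simp only [b]
    rw [div_mul_eq_mul_div]
    gcongr
    calc ‖R ((T ^ 2 ^ n) x)‖ ≤ ‖R‖ * (‖T ^ 2 ^ n‖ * ‖x‖) :=
          (R.le_opNorm _).trans (by gcongr; exact ContinuousLinearMap.le_opNorm _ _)
      _ ≤ ‖R‖ * (M ^ 2 ^ n * ‖x‖) := by
          gcongr
          refine (norm_pow_le' T (by positivity)).trans ?_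
          gcongr
          linarith
      _ = _ := by ring
  have hle : b 0 / M ≤ 1 := by
    by_contra hcon
    push Not at hcon
    obtain ⟨n, hn⟩ := pow_unbounded_of_one_lt (‖R‖ * ‖x‖ / ‖R x‖) hcon
    have h1 : (b 0 / M) ^ n ≤ (b 0 / M) ^ (2 ^ n) :=
      pow_le_pow_right₀ hcon.le Nat.lt_two_pow_self.le
    have h2 : (b 0 / M) ^ (2 ^ n) ≤ ‖R‖ * ‖x‖ / ‖R x‖ := by
      rw [div_pow, div_le_iff₀ (by positivity)]
      exact (hb n).trans (hbd n)
    linarith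
  rw [div_le_one hM0] at hle
  simp only [b, pow_zero, pow_one] at hle
  rwa [div_le_iff₀ hpos] at hle

/-- `u` is a bounded symmetry of the form `⟨a ·, ·⟩` for which `⟨a u ·, ·⟩` is semidefinite. -/
structure IsFormSymmetry (a u : E →L[ℂ] E) : Prop where
  symm : ∀ x y, inner ℂ (a (u x)) y = inner ℂ (a x) (u y)
  nonneg : ∀ x, 0 ≤ (inner ℂ (a (u x)) x).re
  invol : ∀ x, a (u (u x)) = a x

theorem IsFormSymmetry.isPositive {a u : E →L[ℂ] E} (ha : IsSelfAdjoint a)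
    (hu : IsFormSymmetry a u) : (a ∘L u).IsPositive := by
  refine ⟨fun x y => ?_, hu.nonneg⟩
  change inner ℂ (a (u x)) y = inner ℂ x (a (u y))
  rw [hu.symm, ← adjoint_inner_right, show adjoint a = a from ha]

/-- Any two majorants of a form that come from bounded symmetries are equivalent. -/
theorem IsFormSymmetry.exists_le {a u v : E →L[ℂ] E} (ha : IsSelfAdjoint a)
    (hu : IsFormSymmetry a u) (hv : IsFormSymmetry a v) :
    ∃ C, 0 < C ∧ ∀ x, (inner ℂ (a (v x)) x).re ≤ C * (inner ℂ (a (u x)) x).re := by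
  let P : E →L[ℂ] E := a ∘L u
  have hP : 0 ≤ P := (ContinuousLinearMap.nonneg_iff_isPositive _).mpr (hu.isPositive ha)
  let R : E →L[ℂ] E := CFC.sqrt P
  have hRsa : adjoint R = R := (CFC.sqrt_nonneg P).isSelfAdjoint
  have hRR : ∀ x y, inner ℂ (R x) (R y) = inner ℂ (a (u x)) y := by
    intro x y
    rw [← adjoint_inner_left, hRsa]
    have : R (R x) = P x :=
      congrArg (fun T : E →L[ℂ] E => T x) (CFC.sqrt_mul_sqrt_self P hP)
    rw [this]
    rfl
  -- Since a u u = a, the second majorant is ⟨R (T x), R x⟩ for the square root `R` of `a u`, and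
  -- `T` is symmetric for ⟨R ·, R ·⟩.
  let T : E →L[ℂ] E := u ∘L v
  have hT : ∀ x y, inner ℂ (R (T x)) (R y) = inner ℂ (R x) (R (T y)) := by
    intro x y
    rw [hRR, hRR]
    change inner ℂ (a (u (u (v x)))) y = inner ℂ (a (u x)) (u (v y))
    rw [hu.invol, hv.symm, ← hu.symm, hu.invol]
  refine ⟨‖T‖ + 1, by positivity, fun x => ?_⟩
  have h1 : inner ℂ (a (v x)) x = inner ℂ (R (T x)) (R x) := by
    rw [hRR]
    change _ = inner ℂ (a (u (u (v x)))) x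
    rw [hu.invol]
  have h2 : (inner ℂ (a (u x)) x).re = ‖R x‖ ^ 2 := by
    rw [← hRR, inner_self_eq_norm_sq_to_K]
    norm_cast
  rw [h1, h2]
  calc (inner ℂ (R (T x)) (R x)).re ≤ ‖inner ℂ (R (T x)) (R x)‖ := Complex.re_le_norm _
    _ ≤ ‖R (T x)‖ * ‖R x‖ := norm_inner_le_norm _ _
    _ ≤ ((‖T‖ + 1) * ‖R x‖) * ‖R x‖ := by
        gcongr
        exact norm_apply_le_of_symmetric R T hT x
    _ = _ := by ring

theorem isFormSymmetry_polarFactor {a : E →L[ℂ] E} (ha : IsSelfAdjoint a) :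
    IsFormSymmetry a (polarFactor a) where
  symm x y := by
    rw [← inner_polarFactor ha, apply_eq_sqrtAbs_polarFactor ha, apply_eq_sqrtAbs_polarFactor ha,
      polarFactor_sqrtAbs_comm ha, polarFactor_sqrtAbs_comm ha, polarFactor_sqrtAbs_comm ha]
  nonneg x := by
    rw [inner_apply_polarFactor ha]
    exact inner_self_nonneg (𝕜 := ℂ)
  invol x := by
    rw [apply_eq_sqrtAbs_polarFactor ha, apply_eq_sqrtAbs_polarFactor ha x,
      polarFactor_sqrtAbs_comm ha (polarFactor a x), polarFactor_sqrtAbs_comm ha x,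
      polarFactor_polarFactor_sqrtAbs ha]

end Majorant

end SchurHilbert

end

noncomputable section

namespace SchurHilbert

/-! ### The Hilbert space Schur complement as a limit of values of the form. -/

section Schur

variable {E : Type*} [NormedAddCommGroup E] [InnerProductSpace ℂ E] [CompleteSpace E]
  (B : E →L[ℂ] E) (S : Submodule ℂ E) [CompleteSpace S]

omit [CompleteSpace E] in
theorem inner_blockA (s t : S) : inner ℂ (blockA B S s) t = inner ℂ (B s) (t : E) := by
  rw [Submodule.coe_inner]
  exact (Submodule.inner_starProjection_left_eq_right S (B s) t).trans
    (by rw [Submodule.starProjection_eq_self_iff.mpr t.2])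

omit [CompleteSpace E] in
theorem inner_blockB (y : Sᗮ) (t : S) : inner ℂ (blockB B S y) t = inner ℂ (B y) (t : E) := by
  rw [Submodule.coe_inner]
  exact (Submodule.inner_starProjection_left_eq_right S (B y) t).trans
    (by rw [Submodule.starProjection_eq_self_iff.mpr t.2])

omit [CompleteSpace E] in
theorem inner_blockC (y z : Sᗮ) : inner ℂ (blockC B S y) z = inner ℂ (B y) (z : E) := by
  rw [Submodule.coe_inner]
  exact (Submodule.inner_starProjection_left_eq_right Sᗮ (B y) z).trans
    (by rw [Submodule.starProjection_eq_self_iff.mpr z.2])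

variable {B}

theorem isSelfAdjoint_blockA (hB : IsSelfAdjoint B) : IsSelfAdjoint (blockA B S) := by
  rw [ContinuousLinearMap.isSelfAdjoint_iff_isSymmetric]
  intro s t
  change inner ℂ (blockA B S s) t = inner ℂ s (blockA B S t)
  rw [inner_blockA, ← inner_conj_symm s, inner_blockA, inner_conj_symm, ← adjoint_inner_right,
    show adjoint B = B from hB]

theorem isSelfAdjoint_blockC (hB : IsSelfAdjoint B) : IsSelfAdjoint (blockC B S) := by
  rw [ContinuousLinearMap.isSelfAdjoint_iff_isSymmetric]
  intro s t
  change inner ℂ (blockC B S s) t = inner ℂ s (blockC B S t)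
  rw [inner_blockC, ← inner_conj_symm s, inner_blockC, inner_conj_symm, ← adjoint_inner_right,
    show adjoint B = B from hB]

theorem adjoint_schurComplement (hB : IsSelfAdjoint B) (h : WeaklyComplementable B S) :
    adjoint (schurComplement B S h) = schurComplement B S h := by
  have hu := adjoint_polarFactor (isSelfAdjoint_blockA S hB)
  have hc : adjoint (blockC B S) = blockC B S := isSelfAdjoint_blockC S hB
  simp only [schurComplement, ContinuousLinearMap.adjoint_comp, map_sub, hu, hc,
    ContinuousLinearMap.adjoint_adjoint, Submodule.adjoint_subtypeL,
    Submodule.adjoint_orthogonalProjectionOnto, ContinuousLinearMap.comp_assoc]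

/-- Weak complementability in terms of the form `⟨B ·, ·⟩` and the seminorm `‖|a|^{1/2} ·‖`. -/
theorem weaklyComplementable_iff (hB : IsSelfAdjoint B) :
    WeaklyComplementable B S ↔ ∀ x : E, ∃ C : ℝ, ∀ t : S,
      ‖inner ℂ (B x) (t : E)‖ ^ 2 ≤ C * ‖sqrtAbs (blockA B S) t‖ ^ 2 := by
  constructor
  · intro h x
    obtain ⟨d, hd⟩ := h ⟨Sᗮ.orthogonalProjectionOnto x, rfl⟩
    let s : S := S.orthogonalProjectionOnto x
    -- The first summand represents the `S`-component of x through a = r u r, the second its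
    -- component in Sᗮ through the range inclusion.
    let e : S := polarFactor (blockA B S) (sqrtAbs (blockA B S) s) + d
    have he : ∀ t : S, inner ℂ (B x) (t : E) = inner ℂ e (sqrtAbs (blockA B S) t) := by
      intro t
      have hx : x = (s : E) + (Sᗮ.orthogonalProjectionOnto x : Sᗮ) :=
        (Submodule.starProjection_add_starProjection_orthogonal x).symm
      have hd' : inner ℂ (B (Sᗮ.orthogonalProjectionOnto x : Sᗮ)) (t : E) =
          inner ℂ d (sqrtAbs (blockA B S) t) := by
        rw [← inner_blockB, ← inner_sqrtAbs]
        exact congrArg (fun z => inner ℂ z t) hd.symm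
      conv_lhs => rw [hx]
      rw [map_add, inner_add_left, hd', inner_add_left,
        ← inner_sqrtAbs _ (polarFactor _ _),
        ← apply_eq_sqrtAbs_polarFactor (isSelfAdjoint_blockA S hB), inner_blockA]
    refine ⟨‖e‖ ^ 2, fun t => ?_⟩
    rw [he, ← mul_pow]
    gcongr
    exact norm_inner_le_norm _ _
  · rintro h _ ⟨y, rfl⟩
    obtain ⟨C, hC⟩ := h y
    refine mem_range_of_norm_inner_le (adjoint_sqrtAbs (blockA B S)) (C := C) fun t => ?_
    have := hC t
    rw [← inner_blockB] at this
    exact this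

theorem inner_schurComplement (h : WeaklyComplementable B S) (x : E) :
    inner ℂ (schurComplement B S h x) x =
      inner ℂ (B (Sᗮ.orthogonalProjectionOnto x : Sᗮ)) (Sᗮ.orthogonalProjectionOnto x : E) -
      inner ℂ (polarFactor (blockA B S)
          (reducedSolution (sqrtAbs (blockA B S)) (blockB B S) h (Sᗮ.orthogonalProjectionOnto x)))
        (reducedSolution (sqrtAbs (blockA B S)) (blockB B S) h
          (Sᗮ.orthogonalProjectionOnto x)) := by
  set y := Sᗮ.orthogonalProjectionOnto x with hy
  set f := reducedSolution (sqrtAbs (blockA B S)) (blockB B S) h with hf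
  let G : Sᗮ →L[ℂ] Sᗮ := blockC B S - adjoint f ∘L polarFactor (blockA B S) ∘L f
  have h1 : schurComplement B S h x = ((G y : Sᗮ) : E) := rfl
  have h2 : inner ℂ ((G y : Sᗮ) : E) x = inner ℂ (G y) y := by
    rw [Submodule.coe_inner]
    have := Submodule.inner_starProjection_left_eq_right Sᗮ ((G y : Sᗮ) : E) x
    rw [Submodule.starProjection_eq_self_iff.mpr (G y).2] at this
    exact this
  rw [h1, h2]
  change inner ℂ (blockC B S y - adjoint f (polarFactor (blockA B S) (f y))) y = _
  rw [inner_sub_left, inner_blockC, adjoint_inner_left]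

/-- The value at `x` of the quadratic form of the Schur complement is approximated by the values
of the form of `B` at points `x - s` with `s ∈ S` that are almost `B`-orthogonal to `S`. -/
theorem exists_approx (hB : IsSelfAdjoint B) (h : WeaklyComplementable B S) (x : E) {ε : ℝ}
    (hε : 0 < ε) : ∃ s : S,
      |(inner ℂ (B (x - s)) (x - s)).re - (inner ℂ (schurComplement B S h x) x).re| ≤ ε ∧
      ∀ t : S, ‖inner ℂ (B (x - s)) (t : E)‖ ^ 2 ≤ ε * ‖sqrtAbs (blockA B S) t‖ ^ 2 := by
  have ha := isSelfAdjoint_blockA S hB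
  set y := Sᗮ.orthogonalProjectionOnto x with hy
  set f := reducedSolution (sqrtAbs (blockA B S)) (blockB B S) h with hf
  set r := sqrtAbs (blockA B S) with hr
  set u := polarFactor (blockA B S) with hu
  have hspec : IsReducedSolution r (blockB B S) f := reducedSolution_spec _ _ h
  have hfy : f y ∈ r.range.topologicalClosure := by
    have := hspec.2.2 ⟨y, rfl⟩
    rwa [hr, adjoint_sqrtAbs] at this
  -- With this tolerance both ‖d‖² and ‖u‖ ‖d‖² are at most ε. The first controls the almost
  -- orthogonality, the second the error in the value.
  have hδ : 0 < √(ε / (‖u‖ + 1)) := Real.sqrt_pos.mpr (by positivity)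
  obtain ⟨_, ⟨q, rfl⟩, hq⟩ := Metric.mem_closure_iff.mp hfy _ hδ
  have hq' : ‖f y - r q‖ ^ 2 ≤ ε / (‖u‖ + 1) := by
    rw [← Real.sq_sqrt (show 0 ≤ ε / (‖u‖ + 1) by positivity)]
    gcongr
    rw [← dist_eq_norm]
    exact hq.le
  set d := f y - r q with hd
  have hdε : ‖d‖ ^ 2 ≤ ε := hq'.trans (div_le_self hε.le (by linarith [norm_nonneg u]))
  have hudε : ‖u‖ * ‖d‖ ^ 2 ≤ ε := by
    rw [le_div_iff₀ (by positivity)] at hq'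
    nlinarith [sq_nonneg ‖d‖]
  have hxy : ∀ s' : S, x - ((S.orthogonalProjectionOnto x + s' : S) : E) = (y : E) - s' := by
    intro s'
    have hx : x = (S.orthogonalProjectionOnto x : E) + (y : E) :=
      (Submodule.starProjection_add_starProjection_orthogonal x).symm
    rw [Submodule.coe_add]
    nth_rewrite 1 [hx]
    abel
  have hBy : ∀ t : S, inner ℂ (B y) (t : E) = inner ℂ (f y) (r t) := by
    intro t
    rw [← inner_blockB, hspec.1, hr, ← inner_sqrtAbs]
    rfl
  have hBs : ∀ t : S, inner ℂ (B (u q : S)) (t : E) = inner ℂ (r q) (r t) := by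
    intro t
    rw [← inner_blockA, apply_eq_sqrtAbs_polarFactor ha, polarFactor_sqrtAbs_comm ha q,
      polarFactor_polarFactor_sqrtAbs ha, inner_sqrtAbs]
  -- The vector u q nearly solves a s = b y: as u² fixes R(r), a u q = r (r q), whereas b y = r (f
  -- y) and r q is close to f y. The exact error in the value is ⟨u d, d⟩.
  refine ⟨S.orthogonalProjectionOnto x + u q, ?_, fun t => ?_⟩
  · rw [hxy, inner_schurComplement, ← hf, ← hu, ← hy]
    have e1 : inner ℂ (B (u q : S)) (y : E) = inner ℂ (r (u q)) (f y) := by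
      rw [← adjoint_inner_right, show adjoint B = B from hB, ← inner_conj_symm, hBy,
        inner_conj_symm]
    have e2 : inner ℂ (B ((y : E) - (u q : S))) ((y : E) - (u q : S)) -
        (inner ℂ (B y) (y : E) - inner ℂ (u (f y)) (f y)) = inner ℂ (u d) d := by
      simp only [map_sub, inner_sub_left, inner_sub_right, hBy, hBs, e1, hd]
      rw [hr, hu, polarFactor_sqrtAbs_comm ha, inner_polarFactor ha (f y) (sqrtAbs _ q),
        inner_polarFactor ha (sqrtAbs _ q) (sqrtAbs _ q)]
      ring
    rw [← Complex.sub_re, e2]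
    calc |(inner ℂ (u d) d).re| ≤ ‖inner ℂ (u d) d‖ := Complex.abs_re_le_norm _
      _ ≤ ‖u d‖ * ‖d‖ := norm_inner_le_norm _ _
      _ ≤ (‖u‖ * ‖d‖) * ‖d‖ := by gcongr; exact u.le_opNorm d
      _ = ‖u‖ * ‖d‖ ^ 2 := by ring
      _ ≤ ε := hudε
  · rw [hxy, map_sub, inner_sub_left, hBy, hBs, ← inner_sub_left]
    calc ‖inner ℂ d (r t)‖ ^ 2 ≤ (‖d‖ * ‖r t‖) ^ 2 := by
          gcongr
          exact norm_inner_le_norm _ _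
      _ = ‖d‖ ^ 2 * ‖r t‖ ^ 2 := by ring
      _ ≤ _ := by gcongr

end Schur

end SchurHilbert

end

noncomputable section

open IndefiniteMetric

namespace KreinSpace

variable {H : Type*} [AddCommGroup H] [Module ℂ H] [TopologicalSpace H] [KreinSpace H]

/-! ### Quadratic forms and the order of L(H). -/

section Order

/-- The quadratic form `[W x, x]`. -/
def quadForm (W : H →L[ℂ] H) (x : H) : ℝ := (form (W x) x).re

theorem kadjoint_eq_iff {T T' : H →L[ℂ] H} :
    kadjoint T = T' ↔ ∀ x y, form (T x) y = form x (T' y) := by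
  constructor
  · rintro rfl x y
    exact form_kadjoint T x y
  · intro h
    exact (existsUnique_adjoint T).unique (form_kadjoint T) h

theorem isKSelfAdjoint_iff {T : H →L[ℂ] H} :
    IsKSelfAdjoint T ↔ ∀ x y, form (T x) y = form x (T y) :=
  kadjoint_eq_iff

theorem form_kadjoint_left (T : H →L[ℂ] H) (x y : H) :
    form (kadjoint T x) y = form x (T y) := by
  rw [← conj_symm, ← form_kadjoint, conj_symm]

theorem IsKSelfAdjoint.sub {X Y : H →L[ℂ] H} (hX : IsKSelfAdjoint X) (hY : IsKSelfAdjoint Y) :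
    IsKSelfAdjoint (X - Y) := by
  rw [isKSelfAdjoint_iff] at *
  intro x y
  simp [hX x y, hY x y]

theorem IsKSelfAdjoint.neg {X : H →L[ℂ] H} (hX : IsKSelfAdjoint X) : IsKSelfAdjoint (-X) := by
  rw [isKSelfAdjoint_iff] at *
  intro x y
  simp [hX x y]

theorem IsKSelfAdjoint.conjugate {X : H →L[ℂ] H} (hX : IsKSelfAdjoint X) (E : H →L[ℂ] H) :
    IsKSelfAdjoint (kadjoint E ∘L X ∘L E) := by
  rw [isKSelfAdjoint_iff] at *
  intro x y
  simp [form_kadjoint_left, hX, ← form_kadjoint]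

theorem quadForm_conjugate (X E : H →L[ℂ] H) (x : H) :
    quadForm (kadjoint E ∘L X ∘L E) x = quadForm X (E x) := by
  simp [quadForm, form_kadjoint_left]

theorem quadForm_sub (X Y : H →L[ℂ] H) (x : H) :
    quadForm (X - Y) x = quadForm X x - quadForm Y x := by
  simp [quadForm]

theorem quadForm_neg (X : H →L[ℂ] H) (x : H) : quadForm (-X) x = -quadForm X x := by
  simp [quadForm]

theorem quadForm_zero (X : H →L[ℂ] H) : quadForm X 0 = 0 := by
  simp [quadForm]

theorem quadForm_smul (X : H →L[ℂ] H) (c : ℂ) (x : H) :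
    quadForm X (c • x) = ‖c‖ ^ 2 * quadForm X x := by
  have h : form (X (c • x)) (c • x) = ((‖c‖ ^ 2 : ℝ) : ℂ) * form (X x) x := by
    simp only [map_smul, LinearMap.map_smulₛₗ, LinearMap.smul_apply, smul_eq_mul]
    rw [mul_left_comm, ← mul_assoc, ← Complex.normSq_eq_conj_mul_self, Complex.normSq_eq_norm_sq]
  rw [quadForm, h, Complex.re_ofReal_mul]
  rfl

theorem quadForm_add {W : H →L[ℂ] H} (hW : IsKSelfAdjoint W) (x y : H) :
    quadForm W (x + y) = quadForm W x + 2 * (form (W x) y).re + quadForm W y := by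
  have h : (form (W y) x).re = (form (W x) y).re := by
    rw [isKSelfAdjoint_iff.mp hW, ← conj_symm, Complex.conj_re]
  simp only [quadForm, map_add, LinearMap.add_apply, Complex.add_re, h]
  ring

theorem quadForm_sub_arg {W : H →L[ℂ] H} (hW : IsKSelfAdjoint W) (x y : H) :
    quadForm W (x - y) = quadForm W x - 2 * (form (W x) y).re + quadForm W y := by
  have h : quadForm W (-y) = quadForm W y := by simp [quadForm]
  rw [sub_eq_add_neg, quadForm_add hW, h, map_neg, Complex.neg_re]
  ring

theorem KLE.of_quadForm {X Y : H →L[ℂ] H} (hX : IsKSelfAdjoint X) (hY : IsKSelfAdjoint Y)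
    (h : ∀ x, quadForm X x ≤ quadForm Y x) : KLE X Y := by
  refine ⟨hY.sub hX, fun x => ?_⟩
  have := quadForm_sub Y X x
  rw [quadForm] at this
  rw [this]
  exact sub_nonneg.mpr (h x)

theorem KLE.quadForm_le {X Y : H →L[ℂ] H} (h : KLE X Y) (x : H) :
    quadForm X x ≤ quadForm Y x := by
  have h1 := h.2 x
  have h2 := quadForm_sub Y X x
  rw [quadForm] at h2
  rw [h2] at h1
  exact sub_nonneg.mp h1

/-- The competing bounds in `IsKInf` are arbitrary operators. Being comparable with a selfadjoint
operator makes them selfadjoint, so that the order can be tested on quadratic forms. -/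
theorem KLE.isKSelfAdjoint_left {X Y : H →L[ℂ] H} (h : KLE X Y) (hY : IsKSelfAdjoint Y) :
    IsKSelfAdjoint X := by
  have := hY.sub h.1
  rwa [sub_sub_cancel] at this

theorem KLE.isKSelfAdjoint_right {X Y : H →L[ℂ] H} (h : KLE X Y) (hX : IsKSelfAdjoint X) :
    IsKSelfAdjoint Y := by
  have := h.1.sub hX.neg
  rwa [sub_neg_eq_add, sub_add_cancel] at this

theorem kle_neg_iff {X Y : H →L[ℂ] H} : KLE (-X) (-Y) ↔ KLE Y X := by
  rw [KLE, KLE, neg_sub_neg]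

theorem isKInf_neg_iff {A : Set (H →L[ℂ] H)} {X : H →L[ℂ] H} :
    IsKInf ((fun Y => -Y) '' A) (-X) ↔ IsKSup A X := by
  constructor
  · rintro ⟨h1, h2⟩
    refine ⟨fun Y hY => kle_neg_iff.mp (h1 _ ⟨Y, hY, rfl⟩), fun Z hZ => ?_⟩
    refine kle_neg_iff.mp (h2 (-Z) ?_)
    rintro _ ⟨Y, hY, rfl⟩
    exact kle_neg_iff.mpr (hZ Y hY)
  · rintro ⟨h1, h2⟩
    refine ⟨?_, fun Z hZ => ?_⟩
    · rintro _ ⟨Y, hY, rfl⟩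
      exact kle_neg_iff.mpr (h1 Y hY)
    · rw [← neg_neg Z]
      refine kle_neg_iff.mpr (h2 _ fun Y hY => ?_)
      rw [← kle_neg_iff, neg_neg]
      exact hZ _ ⟨Y, hY, rfl⟩

theorem isKSup_neg_iff {A : Set (H →L[ℂ] H)} {X : H →L[ℂ] H} :
    IsKSup ((fun Y => -Y) '' A) (-X) ↔ IsKInf A X := by
  rw [← isKInf_neg_iff, neg_neg, Set.image_image]
  simp

/-- Passing from `W` to `-W` exchanges the two iterated extrema. -/
theorem isSupInf_neg_iff {W : H →L[ℂ] H} {Sp Sm : ClosedSubmodule ℂ H} {X : H →L[ℂ] H} :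
    IsSupInf (-W) Sm Sp (-X) ↔ IsInfSup W Sp Sm X := by
  have hset : ∀ E : H →L[ℂ] H,
      (fun F => kadjoint E ∘L kadjoint F ∘L (-W) ∘L F ∘L E) '' projectionsWithKer Sm =
      (fun Y => -Y) ''
        ((fun F => kadjoint E ∘L kadjoint F ∘L W ∘L F ∘L E) '' projectionsWithKer Sm) := by
    intro E
    rw [Set.image_image]
    refine Set.image_congr fun F _ => ?_
    ext x
    simp
  constructor
  · rintro ⟨g, h1, h2⟩
    refine ⟨fun E => -g E, fun E hE => ?_, ?_⟩
    · rw [← isKInf_neg_iff, neg_neg, ← hset]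
      exact h1 E hE
    · rw [← isKSup_neg_iff, Set.image_image]
      simpa using h2
  · rintro ⟨g, h1, h2⟩
    refine ⟨fun E => -g E, fun E hE => ?_, ?_⟩
    · rw [hset, isKInf_neg_iff]
      exact h1 E hE
    · rw [← isKSup_neg_iff, Set.image_image] at h2
      exact h2

end Order

/-! ### Projections with a prescribed nullspace. -/

section Projections

variable (D : FundamentalDecomposition H)

/-- The projection with nullspace `S` that is orthogonal in the Hilbert space of `D`. -/
def orthoProj (S : ClosedSubmodule ℂ H) : H →L[ℂ] H :=
  D.opKrein (1 - (D.subspace S).starProjection)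

theorem toHilb_orthoProj (S : ClosedSubmodule ℂ H) (x : H) :
    D.toHilb (orthoProj D S x) = D.toHilb x - (D.subspace S).starProjection (D.toHilb x) := rfl

theorem toHilb_mem_subspace {S : ClosedSubmodule ℂ H} {x : H} :
    D.toHilb x ∈ D.subspace S ↔ x ∈ S := Iff.rfl

theorem sub_orthoProj_mem (S : ClosedSubmodule ℂ H) (x : H) : x - orthoProj D S x ∈ S := by
  rw [← toHilb_mem_subspace D, map_sub, toHilb_orthoProj, sub_sub_cancel]
  exact Submodule.starProjection_apply_mem _ _

theorem orthoProj_of_mem {S : ClosedSubmodule ℂ H} {x : H} (hx : x ∈ S) :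
    orthoProj D S x = 0 := by
  apply D.toHilb.injective
  rw [toHilb_orthoProj, Submodule.starProjection_eq_self_iff.mpr ((toHilb_mem_subspace D).mpr hx),
    sub_self, map_zero]

theorem inner_orthoProj {S : ClosedSubmodule ℂ H} (x : H) {s : H} (hs : s ∈ S) :
    inner ℂ (D.toHilb (orthoProj D S x)) (D.toHilb s) = 0 := by
  rw [toHilb_orthoProj]
  exact Submodule.inner_left_of_mem_orthogonal ((toHilb_mem_subspace D).mpr hs)
    (Submodule.sub_starProjection_mem_orthogonal _)

theorem orthoProj_of_inner_eq_zero {S : ClosedSubmodule ℂ H} {x : H}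
    (hx : ∀ s ∈ S, inner ℂ (D.toHilb s) (D.toHilb x) = 0) : orthoProj D S x = x := by
  apply D.toHilb.injective
  rw [toHilb_orthoProj, (Submodule.starProjection_apply_eq_zero_iff _).mpr, sub_zero]
  exact (Submodule.mem_orthogonal _ _).mpr fun v hv => hx (D.toHilb.symm v) hv

omit [KreinSpace H] in
/-- An operator that annihilates `S` and is the identity modulo `S` is a projection. -/
theorem mem_projectionsWithKer {S : ClosedSubmodule ℂ H} {E : H →L[ℂ] H}
    (h₁ : ∀ x ∈ S, E x = 0) (h₂ : ∀ x, x - E x ∈ S) : E ∈ projectionsWithKer S := by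
  refine ⟨?_, fun x => ⟨fun hx => ?_, h₁ x⟩⟩
  · ext x
    have := h₁ _ (h₂ x)
    rw [map_sub, sub_eq_zero] at this
    exact this.symm
  · have := h₂ x
    rwa [hx, sub_zero] at this

omit [KreinSpace H] in
theorem sub_apply_mem {S : ClosedSubmodule ℂ H} {E : H →L[ℂ] H} (hE : E ∈ projectionsWithKer S)
    (x : H) : x - E x ∈ S := by
  rw [← hE.2, map_sub, sub_eq_zero]
  exact (congrArg (fun T : H →L[ℂ] H => T x) hE.1).symm

theorem orthoProj_mem (S : ClosedSubmodule ℂ H) : orthoProj D S ∈ projectionsWithKer S :=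
  mem_projectionsWithKer (fun _ hx => orthoProj_of_mem D hx) (sub_orthoProj_mem D S)

theorem projectionsWithKer_nonempty (S : ClosedSubmodule ℂ H) : (projectionsWithKer S).Nonempty := by
  obtain ⟨D, -⟩ := KreinSpace.exists_decomposition (H := H)
  exact ⟨_, orthoProj_mem D S⟩

/-- The projections with nullspace `S` send a vector outside `S` to any vector of its class
modulo `S`. -/
theorem exists_projection_apply_eq {S : ClosedSubmodule ℂ H} {x s : H} (hx : x ∉ S) (hs : s ∈ S) :
    ∃ E ∈ projectionsWithKer S, E x = x - s := by
  obtain ⟨D, -⟩ := KreinSpace.exists_decomposition (H := H)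
  set w := orthoProj D S x with hw
  have hw0 : inner ℂ (D.toHilb w) (D.toHilb w) ≠ (0 : ℂ) := by
    rw [Ne, inner_self_eq_zero]
    intro h
    have h0 : w = 0 := D.toHilb.injective (by rw [h, map_zero])
    exact hx (((orthoProj_mem D S).2 x).mp h0)
  have hwx : inner ℂ (D.toHilb w) (D.toHilb x) = (inner ℂ (D.toHilb w) (D.toHilb w) : ℂ) := by
    have := inner_orthoProj D x (sub_orthoProj_mem D S x)
    rw [map_sub, inner_sub_right, sub_eq_zero] at this
    exact this
  -- This functional vanishes on S and equals 1 at x, so adding the rank-one term φ ⊗ c with c ∈ S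
  -- keeps a projection with nullspace S and moves only the image of x within its class as required.
  let φ : D.Hilb →L[ℂ] ℂ := (inner ℂ (D.toHilb w) (D.toHilb w))⁻¹ • innerSL ℂ (D.toHilb w)
  have hφ : ∀ z, φ (D.toHilb z) =
      (inner ℂ (D.toHilb w) (D.toHilb w))⁻¹ * inner ℂ (D.toHilb w) (D.toHilb z) := fun _ => rfl
  let c : H := x - w - s
  have hc : c ∈ S := S.toSubmodule.sub_mem (sub_orthoProj_mem D S x) hs
  let E : H →L[ℂ] H := orthoProj D S + D.opKrein (φ.smulRight (D.toHilb c))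
  have hE : ∀ z, E z = orthoProj D S z + φ (D.toHilb z) • c := fun _ => rfl
  refine ⟨E, mem_projectionsWithKer (fun z hz => ?_) (fun z => ?_), ?_⟩
  · rw [hE, orthoProj_of_mem D hz, hφ, inner_orthoProj D x hz, mul_zero, zero_smul, add_zero]
  · rw [hE, ← sub_sub]
    exact S.toSubmodule.sub_mem (sub_orthoProj_mem D S z) (S.toSubmodule.smul_mem _ hc)
  · rw [hE, hφ, hwx, inv_mul_cancel₀ hw0, one_smul, ← hw]
    simp only [c]
    abel

end Projections

end KreinSpace

end

noncomputable section

open IndefiniteMetric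

namespace KreinSpace

variable {H : Type*} [AddCommGroup H] [Module ℂ H] [TopologicalSpace H] [KreinSpace H]

/-- Makes {0} closed, so that it can serve as the second summand in `IsDecomposition.left`. -/
instance t1Space : T1Space H := by
  obtain ⟨D, -⟩ := KreinSpace.exists_decomposition (H := H)
  exact D.toHilb.toHomeomorph.isEmbedding.t1Space

/-! ### Weak complementability without signature operators. -/

section Majorant

variable (D : FundamentalDecomposition H) (W : H →L[ℂ] H)

theorem inner_signatureMul (x y : H) :
    inner ℂ (D.signatureMul W (D.toHilb x)) (D.toHilb y) = form (W x) y := by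
  change form (D.signature (D.signature (W x))) y = _
  rw [D.signature_signature]

variable {W}

theorem isSelfAdjoint_signatureMul (hW : IsKSelfAdjoint W) :
    IsSelfAdjoint (D.signatureMul W) := by
  rw [ContinuousLinearMap.isSelfAdjoint_iff_isSymmetric]
  intro x y
  obtain ⟨x, rfl⟩ := D.toHilb.surjective x
  obtain ⟨y, rfl⟩ := D.toHilb.surjective y
  change inner ℂ (D.signatureMul W (D.toHilb x)) (D.toHilb y) =
    inner ℂ (D.toHilb x) (D.signatureMul W (D.toHilb y))
  rw [inner_signatureMul, ← inner_conj_symm, inner_signatureMul, conj_symm,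
    isKSelfAdjoint_iff.mp hW]

theorem form_schurComplementWrt {S : ClosedSubmodule ℂ H} (h : WeaklyComplementableWrt D W S)
    (x y : H) : form (schurComplementWrt D W S h x) y =
      inner ℂ (SchurHilbert.schurComplement (D.signatureMul W) (D.subspace S) h (D.toHilb x))
        (D.toHilb y) := rfl

theorem isKSelfAdjoint_schurComplementWrt (hW : IsKSelfAdjoint W) {S : ClosedSubmodule ℂ H}
    (h : WeaklyComplementableWrt D W S) : IsKSelfAdjoint (schurComplementWrt D W S h) := by
  rw [isKSelfAdjoint_iff]
  intro x y
  rw [← conj_symm x, form_schurComplementWrt, form_schurComplementWrt, inner_conj_symm,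
    ← ContinuousLinearMap.adjoint_inner_right]
  exact congrArg (fun T : D.Hilb →L[ℂ] D.Hilb => inner ℂ (D.toHilb x) (T (D.toHilb y)))
    (SchurHilbert.adjoint_schurComplement _ (isSelfAdjoint_signatureMul D hW) h)

variable {D} {S Sp Sm : ClosedSubmodule ℂ H}

theorem IsDecomposition.form_eq_zero' (hW : IsKSelfAdjoint W) (hS : IsDecomposition D W S Sp Sm)
    {s t : H} (hs : s ∈ Sm) (ht : t ∈ Sp) : form (W s) t = 0 := by
  rw [isKSelfAdjoint_iff.mp hW, ← conj_symm, hS.form_eq_zero t ht s hs, map_zero]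

theorem IsDecomposition.exists_add (hS : IsDecomposition D W S Sp Sm) {x : H} (hx : x ∈ S) :
    ∃ p ∈ Sp, ∃ m ∈ Sm, p + m = x :=
  Submodule.mem_sup.mp (show x ∈ Sp.toSubmodule ⊔ Sm.toSubmodule by rw [hS.sum_eq]; exact hx)

theorem IsDecomposition.add_mem (hS : IsDecomposition D W S Sp Sm) {p m : H} (hp : p ∈ Sp)
    (hm : m ∈ Sm) : p + m ∈ S := by
  change p + m ∈ S.toSubmodule
  rw [← hS.sum_eq]
  exact Submodule.add_mem_sup hp hm

theorem IsDecomposition.neg (hS : IsDecomposition D W S Sp Sm) (hW : IsKSelfAdjoint W) :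
    IsDecomposition D (-W) S Sm Sp where
  disjoint := hS.disjoint.symm
  sum_eq := by rw [sup_comm, hS.sum_eq]
  form_eq_zero s hs t ht := by simp [hS.form_eq_zero' hW hs ht]
  nonneg s hs := by simpa using hS.nonpos s hs
  nonpos s hs := by simpa using hS.nonneg s hs
  inner_eq_zero s hs t ht := by
    rw [← inner_conj_symm, hS.inner_eq_zero t ht s hs, map_zero]

/-- Lets every result about S be applied to S₊ alone, where the saddle value becomes an infimum. -/
theorem IsDecomposition.left (hS : IsDecomposition D W S Sp Sm) :
    IsDecomposition D W Sp Sp ⊥ where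
  disjoint := disjoint_bot_right
  sum_eq := sup_bot_eq _
  form_eq_zero s _ t ht := by
    obtain rfl : t = 0 := ht
    simp
  nonneg := hS.nonneg
  nonpos s hs := by
    obtain rfl : s = 0 := hs
    simp
  inner_eq_zero s _ t ht := by
    obtain rfl : t = 0 := ht
    simp

theorem IsDecomposition.form_add_add (hW : IsKSelfAdjoint W) (hS : IsDecomposition D W S Sp Sm)
    {p m p' m' : H} (hp : p ∈ Sp) (hm : m ∈ Sm) (hp' : p' ∈ Sp) (hm' : m' ∈ Sm) :
    form (W (p + m)) (p' + m') = form (W p) p' + form (W m) m' := by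
  simp [hS.form_eq_zero p hp m' hm', hS.form_eq_zero' hW hm hp']

variable (D) in
/-- The operator `|a|^{1/2}` of the Hilbert space of `D`, where `a` is the compression to `S` of
the form `[W ·, ·]`. -/
abbrev sqrtBlock (W : H →L[ℂ] H) (S : ClosedSubmodule ℂ H) :
    D.subspace S →L[ℂ] D.subspace S :=
  SchurHilbert.sqrtAbs (SchurHilbert.blockA (D.signatureMul W) (D.subspace S))

/-- The seminorm `‖|a|^{1/2} ·‖`, formed in the Hilbert space of any signature operator, is
equivalent to the seminorm `([W s₊, s₊] - [W s₋, s₋])^{1/2}` of the decomposition. -/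
theorem IsDecomposition.exists_equiv (hW : IsKSelfAdjoint W) (hS : IsDecomposition D W S Sp Sm)
    (D' : FundamentalDecomposition H) : ∃ C : ℝ, 0 < C ∧ ∀ t : D'.subspace S, ∀ p ∈ Sp, ∀ m ∈ Sm,
      D'.toHilb (p + m) = t →
      ‖sqrtBlock D' W S t‖ ^ 2 ≤ C * (quadForm W p - quadForm W m) ∧
      quadForm W p - quadForm W m ≤ C * ‖sqrtBlock D' W S t‖ ^ 2 := by
  -- The orthogonality of S₊ and S₋ is what makes this everywhere defined bounded operator act on S
  -- as p + m ↦ p - m. Boundedness is then available in the Hilbert space of `D'` too.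
  let V₀ : H →L[ℂ] H := orthoProj D Sm - orthoProj D Sp
  have hV₀ : ∀ p ∈ Sp, ∀ m ∈ Sm, V₀ (p + m) = p + -m := by
    intro p hp m hm
    have h1 : orthoProj D Sm p = p := orthoProj_of_inner_eq_zero D fun s hs => by
      rw [← inner_conj_symm, hS.inner_eq_zero p hp s hs, map_zero]
    have h2 : orthoProj D Sp m = m := orthoProj_of_inner_eq_zero D fun s hs =>
      hS.inner_eq_zero s hs m hm
    simp [V₀, h1, h2, orthoProj_of_mem D hp, orthoProj_of_mem D hm, sub_eq_add_neg]
  let V₁ : D'.subspace S →L[ℂ] D'.Hilb := D'.opHilb V₀ ∘L (D'.subspace S).subtypeL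
  have hV₁ : ∀ t, V₁ t ∈ D'.subspace S := by
    intro t
    obtain ⟨p, hp, m, hm, h⟩ := hS.exists_add (x := D'.toHilb.symm t) t.2
    change V₀ (D'.toHilb.symm t) ∈ S
    rw [← h, hV₀ p hp m hm]
    exact hS.add_mem hp (Sm.toSubmodule.neg_mem hm)
  let V : D'.subspace S →L[ℂ] D'.subspace S := V₁.codRestrict _ hV₁
  let a := SchurHilbert.blockA (D'.signatureMul W) (D'.subspace S)
  have ha : IsSelfAdjoint a :=
    SchurHilbert.isSelfAdjoint_blockA _ (isSelfAdjoint_signatureMul D' hW)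
  have hdec : ∀ t : D'.subspace S, ∃ p ∈ Sp, ∃ m ∈ Sm, D'.toHilb (p + m) = t := by
    intro t
    obtain ⟨p, hp, m, hm, h⟩ := hS.exists_add (x := D'.toHilb.symm t) t.2
    exact ⟨p, hp, m, hm, by rw [h, ContinuousLinearEquiv.apply_symm_apply]⟩
  have hV : ∀ t : D'.subspace S, ∀ p ∈ Sp, ∀ m ∈ Sm, D'.toHilb (p + m) = t →
      D'.toHilb (p + -m) = (V t : D'.Hilb) := by
    intro t p hp m hm h
    change _ = D'.toHilb (V₀ (D'.toHilb.symm t))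
    rw [← h, ContinuousLinearEquiv.symm_apply_apply, hV₀ p hp m hm]
  have hform : ∀ t t' : D'.subspace S, ∀ p ∈ Sp, ∀ m ∈ Sm, ∀ p' ∈ Sp, ∀ m' ∈ Sm,
      D'.toHilb (p + m) = t → D'.toHilb (p' + m') = t' →
      inner ℂ (a t) t' = form (W p) p' + form (W m) m' := by
    intro t t' p hp m hm p' hp' m' hm' h h'
    rw [SchurHilbert.inner_blockA, ← h, ← h', inner_signatureMul,
      hS.form_add_add hW hp hm hp' hm']
  -- W-orthogonality gives the symmetry, and the signs of W on S₊ and S₋ give semidefiniteness. The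
  -- majorant of `V` is Q(p) - Q(m).
  have hsym : SchurHilbert.IsFormSymmetry a V := by
    refine ⟨fun x y => ?_, fun x => ?_, fun x => ?_⟩
    · obtain ⟨p, hp, m, hm, h⟩ := hdec x
      obtain ⟨p', hp', m', hm', h'⟩ := hdec y
      rw [hform (V x) y p hp (-m) (Sm.toSubmodule.neg_mem hm) p' hp' m' hm' (hV x p hp m hm h) h',
        hform x (V y) p hp m hm p' hp' (-m') (Sm.toSubmodule.neg_mem hm') h
          (hV y p' hp' m' hm' h')]
      simp
    · obtain ⟨p, hp, m, hm, h⟩ := hdec x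
      rw [hform (V x) x p hp (-m) (Sm.toSubmodule.neg_mem hm) p hp m hm (hV x p hp m hm h) h]
      have h1 := hS.nonneg p hp
      have h2 := hS.nonpos m hm
      simp only [map_neg, LinearMap.neg_apply, Complex.add_re, Complex.neg_re]
      linarith
    · obtain ⟨p, hp, m, hm, h⟩ := hdec x
      have h1 := hV _ p hp (-m) (Sm.toSubmodule.neg_mem hm) (hV x p hp m hm h)
      rw [neg_neg, h] at h1
      rw [← Subtype.ext h1]
  have hq : ∀ t : D'.subspace S, ∀ p ∈ Sp, ∀ m ∈ Sm, D'.toHilb (p + m) = t →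
      (inner ℂ (a (V t)) t).re = quadForm W p - quadForm W m := by
    intro t p hp m hm h
    rw [hform (V t) t p hp (-m) (Sm.toSubmodule.neg_mem hm) p hp m hm (hV t p hp m hm h) h]
    simp [quadForm, sub_eq_add_neg]
  have hr : ∀ t : D'.subspace S, (inner ℂ (a (SchurHilbert.polarFactor a t)) t).re =
      ‖sqrtBlock D' W S t‖ ^ 2 := by
    intro t
    rw [SchurHilbert.inner_apply_polarFactor ha, inner_self_eq_norm_sq_to_K]
    norm_cast
  have hpol := SchurHilbert.isFormSymmetry_polarFactor ha
  obtain ⟨C₁, hC₁, h₁⟩ := hsym.exists_le ha hpol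
  obtain ⟨C₂, hC₂, h₂⟩ := hpol.exists_le ha hsym
  refine ⟨C₁ + C₂, by positivity, fun t p hp m hm h => ?_⟩
  have e₁ := h₁ t
  have e₂ := h₂ t
  have hn : 0 ≤ quadForm W p - quadForm W m := by
    rw [← hq t p hp m hm h]
    exact hsym.nonneg t
  rw [hr, hq t p hp m hm h] at e₁ e₂
  constructor
  · exact e₁.trans (by gcongr; linarith)
  · exact e₂.trans (by gcongr; linarith)

/-- The functionals `[W x, ·]` are bounded on `S₊ ∔ S₋` for the seminorm
`([W s₊, s₊] - [W s₋, s₋])^{1/2}`. -/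
def FormBounded (W : H →L[ℂ] H) (Sp Sm : ClosedSubmodule ℂ H) : Prop :=
  ∀ x, ∃ C : ℝ, ∀ p ∈ Sp, ∀ m ∈ Sm,
    ‖form (W x) (p + m)‖ ^ 2 ≤ C * (quadForm W p - quadForm W m)

theorem FormBounded.neg (h : FormBounded W Sp Sm) : FormBounded (-W) Sm Sp := by
  intro x
  obtain ⟨C, hC⟩ := h x
  refine ⟨C, fun p hp m hm => ?_⟩
  have h1 := hC m hm p hp
  rw [_root_.neg_apply, map_neg, LinearMap.neg_apply, norm_neg, quadForm_neg,
    quadForm_neg, add_comm p, neg_sub_neg]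
  exact h1

/-- The right-hand side does not involve `D'`, so weak complementability for one signature operator
gives it for all. -/
theorem IsDecomposition.weaklyComplementableWrt_iff (hW : IsKSelfAdjoint W)
    (hS : IsDecomposition D W S Sp Sm) (D' : FundamentalDecomposition H) :
    WeaklyComplementableWrt D' W S ↔ FormBounded W Sp Sm := by
  obtain ⟨K, hK, hequiv⟩ := hS.exists_equiv hW D'
  rw [WeaklyComplementableWrt,
    SchurHilbert.weaklyComplementable_iff _ (isSelfAdjoint_signatureMul D' hW)]
  constructor
  · intro h x
    obtain ⟨C, hC⟩ := h (D'.toHilb x)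
    refine ⟨|C| * K, fun p hp m hm => ?_⟩
    let t : D'.subspace S := ⟨D'.toHilb (p + m), hS.add_mem hp hm⟩
    have h1 := hC t
    rw [inner_signatureMul] at h1
    calc _ ≤ _ := h1
      _ ≤ |C| * ‖sqrtBlock D' W S t‖ ^ 2 := by gcongr; exact le_abs_self C
      _ ≤ |C| * (K * (quadForm W p - quadForm W m)) := by
          gcongr
          exact (hequiv t p hp m hm rfl).1
      _ = _ := by ring
  · intro h x
    obtain ⟨C, hC⟩ := h (D'.toHilb.symm x)
    refine ⟨|C| * K, fun t => ?_⟩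
    obtain ⟨p, hp, m, hm, hpm⟩ := hS.exists_add (x := D'.toHilb.symm t) t.2
    have ht : D'.toHilb (p + m) = t := by rw [hpm, ContinuousLinearEquiv.apply_symm_apply]
    have h1 := hC p hp m hm
    rw [← inner_signatureMul D', ht, ContinuousLinearEquiv.apply_symm_apply] at h1
    have hn : 0 ≤ quadForm W p - quadForm W m := by
      have e1 := hS.nonneg p hp
      have e2 := hS.nonpos m hm
      simp only [quadForm]
      linarith
    calc _ ≤ _ := h1
      _ ≤ |C| * (quadForm W p - quadForm W m) := by gcongr; exact le_abs_self C
      _ ≤ |C| * (K * ‖sqrtBlock D' W S t‖ ^ 2) := by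
          gcongr
          exact (hequiv t p hp m hm ht).2
      _ = _ := by ring

end Majorant

/-! ### The Schur complement as a saddle value. -/

section Saddle

/-- `v` is the saddle value of `(s₊, s₋) ↦ [W (x - s₊ - s₋), x - s₊ - s₋]`, to be minimised over
`S₊` and maximised over `S₋`. -/
def IsSaddleValue (W : H →L[ℂ] H) (Sp Sm : ClosedSubmodule ℂ H) (x : H) (v : ℝ) : Prop :=
  ∀ ε > 0, ∃ p ∈ Sp, ∃ m ∈ Sm, (∀ t ∈ Sp, v - ε ≤ quadForm W (x - m - t)) ∧
    ∀ t ∈ Sm, quadForm W (x - t - p) ≤ v + ε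

variable {W : H →L[ℂ] H} {S Sp Sm : ClosedSubmodule ℂ H} {D : FundamentalDecomposition H}

theorem IsSaddleValue.neg {x : H} {v : ℝ} (h : IsSaddleValue W Sp Sm x v) :
    IsSaddleValue (-W) Sm Sp x (-v) := by
  intro ε hε
  obtain ⟨p, hp, m, hm, h1, h2⟩ := h ε hε
  refine ⟨m, hm, p, hp, fun t ht => ?_, fun t ht => ?_⟩
  · rw [quadForm_neg, sub_right_comm]
    linarith [h2 t ht]
  · rw [quadForm_neg, sub_right_comm]
    linarith [h1 t ht]

/-- The quadratic form of the Schur complement, for any signature operator, is the saddle value. -/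
theorem IsDecomposition.isSaddleValue (hW : IsKSelfAdjoint W) (hS : IsDecomposition D W S Sp Sm)
    (D' : FundamentalDecomposition H) (h : WeaklyComplementableWrt D' W S) (x : H) :
    IsSaddleValue W Sp Sm x (quadForm (schurComplementWrt D' W S h) x) := by
  obtain ⟨K, hK, hequiv⟩ := hS.exists_equiv hW D'
  intro ε hε
  obtain ⟨s, h1, h2⟩ := SchurHilbert.exists_approx (D'.subspace S)
    -- With δ = ε / (K + 1), the error δ in the value and the error δ K from the cross term add up
    -- to ε.
    (isSelfAdjoint_signatureMul D' hW) h (D'.toHilb x) (ε := ε / (K + 1)) (by positivity)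
  obtain ⟨p, hp, m, hm, hpm⟩ := hS.exists_add (x := D'.toHilb.symm s) s.2
  have hs : D'.toHilb (p + m) = s := by rw [hpm, ContinuousLinearEquiv.apply_symm_apply]
  set w := x - (p + m) with hw
  rw [← hs, ← map_sub, ← hw] at h1 h2
  rw [inner_signatureMul, ← form_schurComplementWrt] at h1
  change |quadForm W w - quadForm (schurComplementWrt D' W S h) x| ≤ _ at h1
  set v := quadForm (schurComplementWrt D' W S h) x
  have hbound : ∀ p ∈ Sp, ∀ m ∈ Sm,
      (form (W w) (p + m)).re ^ 2 ≤ ε / (K + 1) * (K * (quadForm W p - quadForm W m)) := by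
    intro p hp m hm
    let t : D'.subspace S := ⟨D'.toHilb (p + m), hS.add_mem hp hm⟩
    have h3 := h2 t
    rw [inner_signatureMul] at h3
    calc (form (W w) (p + m)).re ^ 2 = |(form (W w) (p + m)).re| ^ 2 := (sq_abs _).symm
      _ ≤ ‖form (W w) (p + m)‖ ^ 2 := by gcongr; exact Complex.abs_re_le_norm _
      _ ≤ _ := h3
      _ ≤ _ := by gcongr; exact (hequiv t p hp m hm rfl).1
  have hδ : ε / (K + 1) + ε / (K + 1) * K = ε := by field_simp; ring
  set δ := ε / (K + 1)
  have hδ0 : 0 < δ := by positivity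
  have habs := abs_le.mp h1
  -- The arithmetic-geometric mean inequality: the cross term 2c is absorbed by the definite
  -- quadratic term of the move, up to δ K.
  have key : ∀ c Q : ℝ, c ^ 2 ≤ δ * (K * Q) → 0 ≤ Q → |2 * c| ≤ Q + δ * K := by
    intro c Q hc hQ
    refine abs_le_of_sq_le_sq ?_ (by positivity)
    nlinarith [sq_nonneg (Q - δ * K)]
  refine ⟨p, hp, m, hm, fun t ht => ?_, fun t ht => ?_⟩
  · have hpt : p - t ∈ Sp := Sp.toSubmodule.sub_mem hp ht
    have e : x - m - t = w + (p - t) := by rw [hw]; abel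
    have h3 := hbound (p - t) hpt 0 Sm.toSubmodule.zero_mem
    rw [quadForm_zero, add_zero, sub_zero] at h3
    have h4 := abs_le.mp (key _ _ h3 (hS.nonneg _ hpt))
    rw [e, quadForm_add hW]
    linarith [h4.1, habs.1]
  · have hmt : m - t ∈ Sm := Sm.toSubmodule.sub_mem hm ht
    have e : x - t - p = w + (m - t) := by rw [hw]; abel
    have h3 := hbound 0 Sp.toSubmodule.zero_mem (m - t) hmt
    rw [quadForm_zero, zero_add, zero_sub] at h3
    have h4 := abs_le.mp (key _ _ h3 (neg_nonneg.mpr (hS.nonpos _ hmt)))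
    rw [e, quadForm_add hW]
    linarith [h4.2, habs.2]

end Saddle

/-! ### Iterated extrema over projections. -/

section Extrema

variable {W : H →L[ℂ] H} {S Sp Sm : ClosedSubmodule ℂ H} {D : FundamentalDecomposition H}

/-- If the quadratic form of `T` is the infimum of that of `W` over the classes modulo `S₊`, then
`E^# T E` is the infimum of `E^# F^# W F E` over the projections `F` with nullspace `S₊`. -/
theorem isKInf_conjugate (hW : IsKSelfAdjoint W) {T : H →L[ℂ] H} (hT : IsKSelfAdjoint T)
    (hpos : ∀ s ∈ Sp, 0 ≤ quadForm W s)
    (h : ∀ x, IsGLB ((fun s => quadForm W (x - s)) '' (Sp : Set H)) (quadForm T x))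
    (E : H →L[ℂ] H) :
    IsKInf ((fun F => kadjoint E ∘L kadjoint F ∘L W ∘L F ∘L E) '' projectionsWithKer Sp)
      (kadjoint E ∘L T ∘L E) := by
  have hsa : ∀ F, IsKSelfAdjoint (kadjoint E ∘L kadjoint F ∘L W ∘L F ∘L E) := fun F =>
    (hW.conjugate F).conjugate E
  have hq : ∀ F x, quadForm (kadjoint E ∘L kadjoint F ∘L W ∘L F ∘L E) x =
      quadForm W (F (E x)) := fun F x =>
    (quadForm_conjugate (kadjoint F ∘L W ∘L F) E x).trans (quadForm_conjugate W F (E x))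
  refine ⟨?_, fun Z hZ => ?_⟩
  · rintro _ ⟨F, hF, rfl⟩
    refine KLE.of_quadForm (hT.conjugate E) (hsa F) fun x => ?_
    rw [hq, quadForm_conjugate]
    refine (h (E x)).1 ⟨E x - F (E x), sub_apply_mem hF _, ?_⟩
    simp only [sub_sub_cancel]
  · obtain ⟨F₀, hF₀⟩ := projectionsWithKer_nonempty Sp
    have hZsa : IsKSelfAdjoint Z := (hZ _ ⟨F₀, hF₀, rfl⟩).isKSelfAdjoint_left (hsa F₀)
    have hZle : ∀ F ∈ projectionsWithKer Sp, ∀ x, quadForm Z x ≤ quadForm W (F (E x)) := by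
      intro F hF x
      rw [← hq]
      exact (hZ _ ⟨F, hF, rfl⟩).quadForm_le x
    refine KLE.of_quadForm hZsa (hT.conjugate E) fun x => ?_
    rw [quadForm_conjugate]
    refine (h (E x)).2 ?_
    rintro _ ⟨s, hs, rfl⟩
    -- If E x lies in S₊, every F kills it and only Z(x) ≤ 0 is known. This suffices because W is
    -- nonnegative on S₊.
    by_cases hx : E x ∈ Sp
    · have h0 := hZle F₀ hF₀ x
      rw [(hF₀.2 _).mpr hx, quadForm_zero] at h0
      exact h0.trans (hpos _ (Sp.toSubmodule.sub_mem hx hs))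
    · obtain ⟨F, hF, hFx⟩ := exists_projection_apply_eq hx hs
      have h0 := hZle F hF x
      rwa [hFx] at h0

/-- A selfadjoint operator whose quadratic form is the saddle value is the iterated extremum. -/
theorem IsDecomposition.isSupInf (hW : IsKSelfAdjoint W) (hS : IsDecomposition D W S Sp Sm)
    (hb : FormBounded W Sp Sm) {X : H →L[ℂ] H} (hX : IsKSelfAdjoint X)
    (hsad : ∀ x, IsSaddleValue W Sp Sm x (quadForm X x)) : IsSupInf W Sp Sm X := by
  have hb' : FormBounded W Sp ⊥ := by
    intro x
    obtain ⟨C, hC⟩ := hb x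
    refine ⟨C, fun p hp m hm => ?_⟩
    obtain rfl : m = 0 := hm
    exact hC p hp 0 Sm.toSubmodule.zero_mem
  have hwc : WeaklyComplementableWrt D W Sp := (hS.left.weaklyComplementableWrt_iff hW D).mpr hb'
  let T := schurComplementWrt D W Sp hwc
  have hT : IsKSelfAdjoint T := isKSelfAdjoint_schurComplementWrt D hW hwc
  have hglb : ∀ x, IsGLB ((fun s => quadForm W (x - s)) '' (Sp : Set H)) (quadForm T x) := by
    intro x
    have hx := hS.left.isSaddleValue hW D hwc x
    refine ⟨?_, fun b hbd => le_of_forall_pos_le_add fun ε hε => ?_⟩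
    · rintro _ ⟨s, hs, rfl⟩
      refine le_of_forall_pos_le_add fun ε hε => ?_
      obtain ⟨p, -, m, hm, h1, -⟩ := hx ε hε
      obtain rfl : m = 0 := hm
      have h2 := h1 s hs
      rw [sub_zero] at h2
      exact sub_le_iff_le_add.mp h2
    · obtain ⟨p, hp, -, -, -, h1⟩ := hx ε hε
      have h2 := h1 0 rfl
      rw [sub_zero] at h2
      exact (hbd ⟨p, hp, rfl⟩).trans h2
  refine ⟨fun E => kadjoint E ∘L T ∘L E,
    fun E _ => isKInf_conjugate hW hT hS.nonneg hglb E, ?_, fun Z hZ => ?_⟩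
  · rintro _ ⟨E, hE, rfl⟩
    refine KLE.of_quadForm (hT.conjugate E) hX fun x => ?_
    rw [quadForm_conjugate]
    refine le_of_forall_pos_le_add fun ε hε => ?_
    -- The near-optimal p is tried against E: as x - E x is a move in S₋, the value Q(E x - p)
    -- exceeds the saddle value by at most ε.
    obtain ⟨p, hp, m, hm, -, h2⟩ := hsad x ε hε
    refine ((hglb (E x)).1 ⟨p, hp, rfl⟩).trans ?_
    have := h2 _ (sub_apply_mem hE x)
    rwa [sub_sub_cancel] at this
  · obtain ⟨E₀, hE₀⟩ := projectionsWithKer_nonempty Sm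
    have hZsa : IsKSelfAdjoint Z :=
      (hZ _ ⟨E₀, hE₀, rfl⟩).isKSelfAdjoint_right (hT.conjugate E₀)
    have hle : ∀ E ∈ projectionsWithKer Sm, ∀ x, quadForm T (E x) ≤ quadForm Z x := by
      intro E hE x
      rw [← quadForm_conjugate]
      exact (hZ _ ⟨E, hE, rfl⟩).quadForm_le x
    refine KLE.of_quadForm hX hZsa fun x => le_of_forall_pos_le_add fun ε hε => ?_
    obtain ⟨p, hp, m, hm, h1, h2⟩ := hsad x ε hε
    -- All projections with nullspace S₋ kill such an x, so only 0 ≤ Z(x) is known. The saddle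
    -- inequality at t = 0 with Q(x - m) ≤ 0 bounds the form of X at x by ε.
    by_cases hx : x ∈ Sm
    · have h0 := hle E₀ hE₀ x
      have hT0 : quadForm T 0 = 0 := quadForm_zero T
      rw [(hE₀.2 _).mpr hx, hT0] at h0
      have h3 := h1 0 Sp.toSubmodule.zero_mem
      rw [sub_zero] at h3
      have h4 : quadForm W (x - m) ≤ 0 := hS.nonpos _ (Sm.toSubmodule.sub_mem hx hm)
      linarith
    · obtain ⟨E, hE, hEx⟩ := exists_projection_apply_eq hx hm
      have h0 := hle E hE x
      have h3 : quadForm X x - ε ≤ quadForm T (E x) := by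
        refine (hglb (E x)).2 ?_
        rintro _ ⟨t, ht, rfl⟩
        change _ ≤ quadForm W (E x - t)
        rw [hEx]
        exact h1 t ht
      linarith

/-- If `[W (x - s), x - s]` is bounded below for `s ∈ S₊`, then `[W x, ·]` is bounded on `S₊` for
the seminorm `[W s, s]^{1/2}`. -/
theorem exists_norm_form_le (hW : IsKSelfAdjoint W) {x : H} {k : ℝ}
    (hpos : ∀ s ∈ Sp, 0 ≤ quadForm W s) (h : ∀ s ∈ Sp, k ≤ quadForm W (x - s)) :
    ∃ C : ℝ, ∀ s ∈ Sp, ‖form (W x) s‖ ^ 2 ≤ C * quadForm W s := by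
  refine ⟨quadForm W x - k, fun s hs => ?_⟩
  set z := form (W x) s with hz
  -- The lower bound is used at l z̄ s, where the phase z̄ makes the cross term the real number l
  -- ‖z‖². The discriminant of this quadratic in l, divided by 4‖z‖², is the claim.
  have hquad : ∀ l : ℝ, 0 ≤ (‖z‖ ^ 2 * quadForm W s) * (l * l) + (-2 * ‖z‖ ^ 2) * l +
      (quadForm W x - k) := by
    intro l
    have h1 := h _ (Sp.toSubmodule.smul_mem ((l : ℂ) * (starRingEnd ℂ) z) hs)
    rw [quadForm_sub_arg hW, quadForm_smul, map_smul, smul_eq_mul, ← hz, mul_assoc,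
      ← Complex.normSq_eq_conj_mul_self, Complex.re_ofReal_mul, Complex.ofReal_re,
      Complex.normSq_eq_norm_sq, norm_mul, RCLike.norm_conj, Complex.norm_real, mul_pow,
      Real.norm_eq_abs, sq_abs] at h1
    linarith
  have hd := discrim_le_zero hquad
  rw [discrim] at hd
  by_cases h0 : ‖z‖ ^ 2 = 0
  · have h1 := h 0 Sp.toSubmodule.zero_mem
    rw [sub_zero] at h1
    rw [h0]
    exact mul_nonneg (sub_nonneg.mpr h1) (hpos s hs)
  · have hp : 0 < ‖z‖ ^ 2 := lt_of_le_of_ne (by positivity) (Ne.symm h0)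
    have : ‖z‖ ^ 2 * (‖z‖ ^ 2 - (quadForm W x - k) * quadForm W s) ≤ 0 := by nlinarith
    by_contra hcon
    push Not at hcon
    nlinarith

/-- If the inner infima exist, then `[W x, ·]` is bounded on `S₊` for the seminorm
`[W s, s]^{1/2}`. -/
theorem IsDecomposition.exists_norm_form_le_of_isSupInf (hW : IsKSelfAdjoint W)
    (hS : IsDecomposition D W S Sp Sm) {X : H →L[ℂ] H} (hX : IsSupInf W Sp Sm X) (x : H) :
    ∃ C : ℝ, ∀ s ∈ Sp, ‖form (W x) s‖ ^ 2 ≤ C * quadForm W s := by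
  obtain ⟨g, hg, -⟩ := hX
  set E := orthoProj D Sm with hE
  have hEm : E ∈ projectionsWithKer Sm := orthoProj_mem D Sm
  have hEE : E (E x) = E x := congrArg (fun T : H →L[ℂ] H => T x) hEm.1
  have hbdd : ∃ k : ℝ, ∀ s ∈ Sp, k ≤ quadForm W (E x - s) := by
    by_cases hx : E x ∈ Sp
    · exact ⟨0, fun s hs => hS.nonneg _ (Sp.toSubmodule.sub_mem hx hs)⟩
    -- The inner infimum is evaluated at E x, which E fixes. The vectors F (E x) run through the
    -- whole class of E x modulo S₊.
    · refine ⟨quadForm (g E) (E x), fun s hs => ?_⟩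
      obtain ⟨F, hF, hFx⟩ := exists_projection_apply_eq hx hs
      have h1 := ((hg E hEm).1 _ ⟨F, hF, rfl⟩).quadForm_le (E x)
      have h2 := (quadForm_conjugate (kadjoint F ∘L W ∘L F) E (E x)).trans
        (quadForm_conjugate W F (E (E x)))
      rw [hEE, hFx] at h2
      exact h1.trans h2.le
  obtain ⟨k, hk⟩ := hbdd
  obtain ⟨C, hC⟩ := exists_norm_form_le hW hS.nonneg hk
  refine ⟨C, fun s hs => ?_⟩
  -- Since x - E x lies in S₋, which is W-orthogonal to S₊, x and E x give the same functional on
  -- S₊.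
  have h0 := hS.form_eq_zero' hW (sub_apply_mem hEm x) hs
  rw [map_sub, map_sub, LinearMap.sub_apply, sub_eq_zero] at h0
  rw [h0]
  exact hC s hs

theorem IsDecomposition.formBounded (hW : IsKSelfAdjoint W) (hS : IsDecomposition D W S Sp Sm)
    {X Y : H →L[ℂ] H} (hX : IsSupInf W Sp Sm X) (hY : IsInfSup W Sp Sm Y) :
    FormBounded W Sp Sm := by
  intro x
  obtain ⟨C₁, h₁⟩ := hS.exists_norm_form_le_of_isSupInf hW hX x
  obtain ⟨C₂, h₂⟩ := (hS.neg hW).exists_norm_form_le_of_isSupInf hW.neg (isSupInf_neg_iff.mpr hY) x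
  refine ⟨2 * (|C₁| + |C₂|), fun p hp m hm => ?_⟩
  have e₁ := h₁ p hp
  have e₂ := h₂ m hm
  rw [quadForm_neg, _root_.neg_apply, map_neg, LinearMap.neg_apply, norm_neg] at e₂
  have q₁ : 0 ≤ quadForm W p := hS.nonneg p hp
  have q₂ : 0 ≤ -quadForm W m := neg_nonneg.mpr (hS.nonpos m hm)
  have f₁ : C₁ * quadForm W p ≤ (|C₁| + |C₂|) * quadForm W p := by
    gcongr
    linarith [le_abs_self C₁, abs_nonneg C₂]
  have f₂ : C₂ * -quadForm W m ≤ (|C₁| + |C₂|) * -quadForm W m := by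
    gcongr
    linarith [le_abs_self C₂, abs_nonneg C₁]
  have hsum : ‖form (W x) (p + m)‖ ^ 2 ≤ 2 * (‖form (W x) p‖ ^ 2 + ‖form (W x) m‖ ^ 2) := by
    rw [map_add]
    refine (pow_le_pow_left₀ (norm_nonneg _) (norm_add_le _ _) 2).trans ?_
    exact add_sq_le
  linarith

end Extrema

end KreinSpace

end

theorem theorem4p9 {H : Type*} [AddCommGroup H] [Module ℂ H] [TopologicalSpace H] [KreinSpace H]
    (W : H →L[ℂ] H) (hW : KreinSpace.IsKSelfAdjoint W)
    (S Sp Sm : ClosedSubmodule ℂ H) (D : FundamentalDecomposition H)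
    (hS : KreinSpace.IsDecomposition D W S Sp Sm) :
    (KreinSpace.WeaklyComplementable W S ↔
      (∃ X, KreinSpace.IsSupInf W Sp Sm X) ∧ (∃ Y, KreinSpace.IsInfSup W Sp Sm Y)) ∧
    (KreinSpace.WeaklyComplementable W S →
      ∀ D' : FundamentalDecomposition H, ∃ h : KreinSpace.WeaklyComplementableWrt D' W S,
        KreinSpace.IsSupInf W Sp Sm (KreinSpace.schurComplementWrt D' W S h) ∧
        KreinSpace.IsInfSup W Sp Sm (KreinSpace.schurComplementWrt D' W S h)) := by
  have main : KreinSpace.WeaklyComplementable W S →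
      ∀ D' : FundamentalDecomposition H, ∃ h : KreinSpace.WeaklyComplementableWrt D' W S,
        KreinSpace.IsSupInf W Sp Sm (KreinSpace.schurComplementWrt D' W S h) ∧
        KreinSpace.IsInfSup W Sp Sm (KreinSpace.schurComplementWrt D' W S h) := by
    rintro ⟨D₀, h₀⟩ D'
    have hb := (hS.weaklyComplementableWrt_iff hW D₀).mp h₀
    have h := (hS.weaklyComplementableWrt_iff hW D').mpr hb
    have hsa := KreinSpace.isKSelfAdjoint_schurComplementWrt D' hW h
    have hsad := hS.isSaddleValue hW D' h
    refine ⟨h, hS.isSupInf hW hb hsa hsad, KreinSpace.isSupInf_neg_iff.mp ?_⟩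
    -- For -W the roles of S₊ and S₋ are exchanged and the saddle value changes sign.
    refine (hS.neg hW).isSupInf hW.neg hb.neg hsa.neg fun x => ?_
    rw [KreinSpace.quadForm_neg]
    exact (hsad x).neg
  refine ⟨⟨fun h => ?_, ?_⟩, main⟩
  · obtain ⟨_, hX, hY⟩ := main h D
    exact ⟨⟨_, hX⟩, ⟨_, hY⟩⟩
  · rintro ⟨⟨X, hX⟩, ⟨Y, hY⟩⟩
    exact ⟨D, (hS.weaklyComplementableWrt_iff hW D).mpr (hS.formBounded hW hX hY)⟩
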